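/- Let $\Sigma$ be a finite non-empty alphabet, and let $t$ be a tagging that declares each character of $\Sigma$ a call, return or plain symbol; $\Sigma_{\rm call},\Sigma_{\rm ret},\Sigma_{\rm plain}$ are the resulting sets of tagged symbols, $\hat\Sigma$ is their union, and $k=|\Sigma_{\rm call}|$. Let $\mathcal L\subseteq\Sigma^*$ be such that $\hat{\mathcal L}=\{t(s)\mid s\in\mathcal L\}$ is a (well-matched) visibly pushdown language, i.e. generated by a context-free grammar all of whose rules have the form $N\to\varepsilon$, $N\to cN_1$ or $N\to aN_1bN_2$ with $c$ plain, $a$ a call symbol, $b$ a return symbol. A $k$-SEVPA is a deterministic visibly pushdown automaton whose states are partitioned into a base module $0$, which contains the initial state and the final states, and one module with a designated entry state for each call symbol. A plain symbol keeps it in its module. A call symbol $a$ pushes (current state, $a$) and leads to the entry state of the module of $a$. A return symbol pops a pair (state $q'$, call symbol) and leads to a state of the module of $q'$; there is no move if the stack is empty. A word is accepted if the run ends in a final state with empty stack. A $k$-SEVPA for $\hat{\mathcal L}$ is minimal if it has the least number of states among all $k$-SEVPAs that recognize $\hat{\mathcal L}$. Consider the following learner. It knows $\Sigma$ and $t$ and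 has a minimally adequate teacher for $\mathcal L$, which answers membership queries and answers an equivalence query for a hypothesis $k$-SEVPA $H$ by "none" if $\{s\mid t(s)\text{ is accepted by }H\}=\mathcal L$ and otherwise by an arbitrary counterexample. Answers to table queries are stored and not asked again. For each module $i$ the learner keeps a finite set $Q_i$ of access words, initially $\{\varepsilon\}$, and a finite set $C_i$ of tests $(l,r)$, initially $C_0=\{(\varepsilon,\varepsilon)\}$ and $C_a=\{(a,b)\mid b\in\Sigma_{\rm ret}\}$ for the module of $a\in\Sigma_{\rm call}$. Words $u,v$ are $C_i$-equivalent if $lur\in\hat{\mathcal L}\iff lvr\in\hat{\mathcal L}$ for all $(l,r)\in C_i$. Let $\Sigma_M=\Sigma_{\rm plain}\cup\{aqb\mid a\in\Sigma_{\rm call},\,q\in Q_a,\,b\in\Sigma_{\rm ret}\}$. 1. Close: with a work list of all $(q,i,m)$ with $q\in Q_i$, $m\in\Sigma_M$, processed in any order, add $qm$ to $Q_i$ whenever it is not $C_i$-equivalent to any word in $Q_i$, and add the new triples that arise to the work list. 2. Construct the hypothesis: its states are the disjoint union of the $Q_i$, the entry states are the words $\varepsilon$, the final states are the words of $Q_0\cap\hat{\mathcal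 L}$; a plain symbol $c$ leads from $q\in Q_i$ to the word of $Q_i$ that is $C_i$-equivalent to $qc$, and a return symbol $b$ leads from $q\in Q_a$, with $(q',a)$ on top of the stack and $q'\in Q_j$, to the word of $Q_j$ that is $C_j$-equivalent to $q'aqb$. 3. Ask an equivalence query; halt with the hypothesis if there is no counterexample. Otherwise let $s$ be the tagged counterexample. For a prefix of $s$ after which the hypothesis is in state $q$ with stack contents $(q_1,a_1),\dots,(q_r,a_r)$ from bottom to top, and with rest $w'$ of $s$, let its context be $(w,w')$ with $w=q_1a_1\cdots q_ra_r$. By binary search with membership queries find two successive prefixes such that $wqw'$ agrees in membership with $s$ for the first and disagrees for the second. If the symbol between them is plain, $c$ say, add $qc$ to the module of $q$; if it is a return symbol $b$ and $(q',a)$ is on top of the stack, add $q'aqb$ to the module of $q'$. To the tests of the same module add the context of the second prefix. Go to step 1. Then, for every order of processing and all valid answers of the teacher, the learner terminates and its result is the minimal $k$-SEVPA of $\hat{\mathcal L}$, which is unique up to isomorphism. If $m$ is its number of states and $n$ is the maximal length of the counterexamples received, then the learner asks $O(m)$ equivalence queries and $O(m^3|\Sigma|^2+m\log n)$ membership queries,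 with absolute constants in the $O$ (and $\log n$ read as $0$ if there was no counterexample). -/

import Mathlib

universe u v

namespace VStar

/-! ### Tagged alphabets, well-matched visibly pushdown grammars and languages -/

/-- The three kinds of characters. -/
inductive Kind : Type
  | call | ret | plain

/-- Tagged symbols, for sets `C`, `R`, `P` of call, return and plain symbols. -/
inductive Sym (C R P : Type u) : Type u
  | call (a : C)
  | ret (b : R)
  | plain (c : P)

/-- A well-matched visibly pushdown grammar: every rule has one of the forms
`N → ε`, `N → c N₁` (`c` plain), `N → a N₁ b N₂` (`a` a call symbol, `b` a return symbol). -/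
def IsVPG {C R P : Type u} (g : ContextFreeGrammar.{u} (Sym C R P)) : Prop :=
  ∀ r ∈ g.rules,
    r.output = [] ∨
    (∃ (c : P) (N₁ : g.NT), r.output = [.terminal (.plain c), .nonterminal N₁]) ∨
    (∃ (a : C) (N₁ : g.NT) (b : R) (N₂ : g.NT),
      r.output = [.terminal (.call a), .nonterminal N₁, .terminal (.ret b), .nonterminal N₂])

/-- A visibly pushdown language: a language generated by a (well-matched) VPG. -/
def IsVPL {C R P : Type u} (L : Language (Sym C R P)) : Prop :=
  ∃ g : ContextFreeGrammar.{u} (Sym C R P), IsVPG g ∧ g.language = L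

/-- The call symbols of a tagging `t`. -/
abbrev Call {A : Type u} (t : A → Kind) : Type u := {a : A // t a = .call}

/-- The return symbols of a tagging `t`. -/
abbrev Ret {A : Type u} (t : A → Kind) : Type u := {a : A // t a = .ret}

/-- The plain symbols of a tagging `t`. -/
abbrev Plain {A : Type u} (t : A → Kind) : Type u := {a : A // t a = .plain}

/-- The tagged alphabet of a tagging `t`. -/
abbrev Hat {A : Type u} (t : A → Kind) : Type u := Sym (Call t) (Ret t) (Plain t)

/-- The tagged symbol that `t` makes of a character. -/
def tag {A : Type u} (t : A → Kind) (a : A) : Hat t :=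
  match h : t a with
  | .call => .call ⟨a, h⟩
  | .ret => .ret ⟨a, h⟩
  | .plain => .plain ⟨a, h⟩

/-- Removing the tag of a symbol. -/
def untag {A : Type u} {t : A → Kind} : Hat t → A
  | .call a => a.1
  | .ret b => b.1
  | .plain c => c.1

/-- The tagged language `{t(s) | s ∈ L}`. -/
def taggedLanguage {A : Type u} (t : A → Kind) (L : Language A) : Language (Hat t) :=
  {w | ∃ s ∈ L, s.map (tag t) = w}

/-! ### `k`-SEVPAs, where `k` is the number of call symbols -/

/-- A single-entry visibly pushdown automaton with one module for every call symbol
(`Q (some a)`) and a base module (`Q none`). On a call symbol `a`, the automaton pushes the current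
state together with `a` and moves to the entry state of module `a`; on a plain symbol it stays in
its module; on a return symbol `b`, being in state `q` of module `a` with `([q'], a)` on top of the
stack, `q'` in module `j`, it moves to the state `onRet a q b j q'` of the module `j` of the caller.
(Whenever the automaton is in module `a`, the call symbol on top of the stack is `a`.)
There is no move on a return symbol if the stack is empty. -/
structure KSEVPA (C R P : Type u) where
  Q : Option C → Type u
  finite_Q : ∀ i, Finite (Q i)
  entry : ∀ i, Q i
  onPlain : ∀ i, Q i → P → Q i
  onRet : ∀ a : C, Q (some a) → R → ∀ j, Q j → Q j
  final : Set (Q none)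

namespace KSEVPA

variable {C R P : Type u}

/-- The states: the disjoint union of the modules. -/
abbrev State (M : KSEVPA C R P) : Type u := (i : Option C) × M.Q i

/-- Configurations: the current state and the stack (top first). A stack symbol `([q'], a)` is
stored as `q'` alone, since `a` is the module of the state entered when it is pushed, that is,
of the next state up the stack (or the current state). -/
abbrev Conf (M : KSEVPA C R P) : Type u := M.State × List M.State

/-- One move of the automaton; `none` if it is stuck. -/
def step (M : KSEVPA C R P) : M.Conf → Sym C R P → Option M.Conf
  | (p, st), .call a => some (⟨some a, M.entry (some a)⟩, p :: st)
  | (⟨i, q⟩, st), .plain c => some (⟨i, M.onPlain i q c⟩, st)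
  | (⟨some a, q⟩, ⟨j, q'⟩ :: st), .ret b => some (⟨j, M.onRet a q b j q'⟩, st)
  | _, .ret _ => none

/-- The configuration after reading a word from the initial state with empty stack. -/
def run (M : KSEVPA C R P) (w : List (Sym C R P)) : Option M.Conf :=
  w.foldlM M.step (⟨none, M.entry none⟩, [])

/-- Acceptance: in a final state, with empty stack. -/
def Accepts (M : KSEVPA C R P) (w : List (Sym C R P)) : Prop :=
  ∃ q ∈ M.final, M.run w = some (⟨none, q⟩, [])

/-- `M` recognizes the language `L`. -/
def Recognizes (M : KSEVPA C R P) (L : Language (Sym C R P)) : Prop :=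
  ∀ w, M.Accepts w ↔ w ∈ L

/-- The number of states. -/
noncomputable def size (M : KSEVPA C R P) : ℕ := Nat.card M.State

/-- `M` recognizes `L` and has the least number of states among all automata that do. -/
def IsMinimal (M : KSEVPA C R P) (L : Language (Sym C R P)) : Prop :=
  M.Recognizes L ∧ ∀ N : KSEVPA C R P, N.Recognizes L → M.size ≤ N.size

/-- Isomorphisms. -/
structure Iso (M N : KSEVPA C R P) where
  toEquiv : ∀ i, M.Q i ≃ N.Q i
  map_entry : ∀ i, toEquiv i (M.entry i) = N.entry i
  map_onPlain : ∀ i q c, toEquiv i (M.onPlain i q c) = N.onPlain i (toEquiv i q) c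
  map_onRet : ∀ a q b j q',
    toEquiv j (M.onRet a q b j q') = N.onRet a (toEquiv (some a) q) b j (toEquiv j q')
  map_final : ∀ q, toEquiv none q ∈ N.final ↔ q ∈ M.final

end KSEVPA

/-! ### Learners with a minimally adequate teacher, and their query counts -/

/-- What a learner does in a state: continue (nondeterministically) in one of the states of a set,
ask membership queries for a finite set of strings, ask an equivalence query for a hypothesis
(answered by `none`, or by a counterexample), or halt with a result. -/
inductive Action (A : Type u) (Hyp : Type v) (S : Type u) : Type (max u v)
  | goto (N : Set S)
  | memb (F : Finset (List A)) (k : ({w // w ∈ F} → Bool) → S)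
  | equiv (H : Hyp) (k : Option (List A) → S)
  | halt (H : Hyp)

/-- A learner for languages over `A` with hypotheses in `Hyp`. -/
structure Learner (A : Type u) (Hyp : Type v) where
  State : Type u
  start : State
  act : State → Action A Hyp State

/-- A state of a learner, the number of membership and of equivalence queries asked so far, and
the maximal length of the counterexamples received so far. -/
structure Snapshot (S : Type u) where
  state : S
  numMemb : ℕ
  numEquiv : ℕ
  maxLen : ℕ

namespace Learner

variable {A : Type u} {Hyp : Type v}

open Classical in
/-- One step of the learner with a teacher for the language `L`; `lang H` is the language of the
hypothesis `H`. The teacher may return any counterexample. -/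
inductive Step (X : Learner A Hyp) (lang : Hyp → Language A) (L : Language A) :
    Snapshot X.State → Snapshot X.State → Prop
  | goto {s N s' a b n} : X.act s = .goto N → s' ∈ N → Step X lang L ⟨s, a, b, n⟩ ⟨s', a, b, n⟩
  | memb {s F k a b n} : X.act s = .memb F k →
      Step X lang L ⟨s, a, b, n⟩ ⟨k fun w => decide (w.1 ∈ L), a + F.card, b, n⟩
  | equivYes {s H k a b n} : X.act s = .equiv H k → (∀ w, w ∈ L ↔ w ∈ lang H) →
      Step X lang L ⟨s, a, b, n⟩ ⟨k none, a, b + 1, n⟩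
  | equivNo {s H k a b n w} : X.act s = .equiv H k → ¬ (w ∈ L ↔ w ∈ lang H) →
      Step X lang L ⟨s, a, b, n⟩ ⟨k (some w), a, b + 1, max n w.length⟩

/-- The beginning of every run. -/
def init (X : Learner A Hyp) : Snapshot X.State := ⟨X.start, 0, 0, 0⟩

end Learner

/-! ### The table-based learner -/

section Algorithm

variable {A : Type u} {t : A → Kind}

/-- The data of the learner: the access words `Q i` and the tests `C i` of every module, and the
answers to membership queries stored so far. Tests are pairs `(l, r)`, used on a word `q` as
`l q r`; those of the base module have `l = ε`, those of module `a` have an `l` that ends in `a`. -/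
structure Obs (t : A → Kind) where
  Q : Option (Call t) → Finset (List (Hat t))
  C : Option (Call t) → Finset (List (Hat t) × List (Hat t))
  nil_mem : ∀ i, [] ∈ Q i
  memo : List A → Option Bool

/-- The string `l q r`, without tags. -/
def plug (c : List (Hat t) × List (Hat t)) (q : List (Hat t)) : List A :=
  (c.1 ++ q ++ c.2).map untag

namespace Obs

/-- `C i`-equivalence, as read off the stored answers. -/
def Equiv (O : Obs t) (i : Option (Call t)) (q₁ q₂ : List (Hat t)) : Prop :=
  ∀ c ∈ O.C i, O.memo (plug c q₁) = O.memo (plug c q₂)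

open Classical in
/-- Strings in `F` whose membership is not yet known. -/
noncomputable def missing (O : Obs t) (F : Finset (List A)) : Finset (List A) :=
  F.filter fun w => O.memo w = none

open Classical in
/-- Storing the answers for the strings in `F`. -/
noncomputable def record (O : Obs t) (F : Finset (List A)) (ans : {w // w ∈ F} → Bool) : Obs t :=
  { O with memo := fun w => if h : w ∈ F then some (ans ⟨w, h⟩) else O.memo w }

open Classical in
/-- Adding an access word to a module. -/
noncomputable def addState (O : Obs t) (i : Option (Call t)) (q : List (Hat t)) : Obs t :=
  { O with
    Q := Function.update O.Q i (insert q (O.Q i))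
    nil_mem := by
      intro j
      by_cases h : j = i
      · subst h; simp [O.nil_mem]
      · simp [h, O.nil_mem] }

open Classical in
/-- Adding a test to a module. -/
noncomputable def addTest (O : Obs t) (i : Option (Call t)) (c : List (Hat t) × List (Hat t)) :
    Obs t :=
  { O with C := Function.update O.C i (insert c (O.C i)) }

/-- An access word in `Q i` that is `C i`-equivalent to `q` (the default `ε` is never needed if
`O` is closed). -/
noncomputable def target (O : Obs t) (i : Option (Call t)) (q : List (Hat t)) :
    {q // q ∈ O.Q i} :=
  open Classical in
  if h : ∃ q' ∈ O.Q i, O.Equiv i q' q then ⟨h.choose, h.choose_spec.1⟩ else ⟨[], O.nil_mem i⟩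

/-- The hypothesis automaton. -/
noncomputable def construct (O : Obs t) : KSEVPA (Call t) (Ret t) (Plain t) where
  Q i := {q // q ∈ O.Q i}
  finite_Q _ := inferInstance
  entry i := ⟨[], O.nil_mem i⟩
  onPlain i q c := O.target i (q.1 ++ [.plain c])
  onRet a q b j q' := O.target j (q'.1 ++ [.call a] ++ q.1 ++ [.ret b])
  final := {q | O.memo (q.1.map untag) = some true}

/-- The left context `q₁ a₁ q₂ a₂ ⋯ qₙ aₙ` of a configuration of the hypothesis automaton, in terms
of the module of its state and its stack. -/
def leftContext (O : Obs t) : Option (Call t) → List O.construct.State → List (Hat t)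
  | some a, ⟨j, q⟩ :: st => O.leftContext j st ++ q.1 ++ [.call a]
  | _, _ => []

/-- The string `w q w'` where `q` is the state of the hypothesis automaton after reading the first
`n` symbols of `s`, and `(w, w')` is its context. -/
noncomputable def contextString (O : Obs t) (s : List (Hat t)) (n : ℕ) : List A :=
  match O.construct.run (s.take n) with
  | some (⟨i, q⟩, st) => plug (O.leftContext i st, s.drop n) q.1
  | none => []

/-- The new access word and the new test gained from a counterexample `s`, if `n` is a position
where the context strings before and after reading the symbol of `s` at `n` (the first one has
index `0`) differ in membership; that symbol is never a call symbol. -/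
noncomputable def update (O : Obs t) (s : List (Hat t)) (n : ℕ) : Obs t :=
  match O.construct.run (s.take n), s.drop n with
  | some (⟨i, q⟩, st), .plain c :: r =>
      (O.addState i (q.1 ++ [.plain c])).addTest i (O.leftContext i st, r)
  | some (⟨some a, q⟩, ⟨j, q'⟩ :: st), .ret b :: r =>
      (O.addState j (q'.1 ++ [.call a] ++ q.1 ++ [.ret b])).addTest j (O.leftContext j st, r)
  | _, _ => O

variable [Fintype A]

open Classical in
/-- The words `a q b` for a call symbol `a` and all return symbols `b`. -/
noncomputable def nested (a : Call t) (q : List (Hat t)) : Finset (List (Hat t)) :=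
  Finset.univ.image fun b : Ret t => [.call a] ++ q ++ [.ret b]

open Classical in
/-- The set `Σ_M` of plain symbols and nested words. -/
noncomputable def sigmaM (O : Obs t) : Finset (List (Hat t)) :=
  (Finset.univ.image fun c : Plain t => [.plain c]) ∪
    Finset.univ.biUnion fun a : Call t => (O.Q (some a)).biUnion fun q => nested a q

open Classical in
/-- The strings that decide whether `q` is `C i`-equivalent to a word in `Q i`. -/
noncomputable def tests (O : Obs t) (i : Option (Call t)) (q : List (Hat t)) : Finset (List A) :=
  (O.C i).biUnion fun c => (insert q (O.Q i)).image (plug c)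

open Classical in
/-- The strings from which the hypothesis automaton is constructed. -/
noncomputable def table (O : Obs t) : Finset (List A) :=
  (O.Q none).image (List.map untag) ∪
  Finset.univ.biUnion fun i : Option (Call t) => (O.C i).biUnion fun c => (O.Q i).biUnion fun q =>
    insert (plug c q) (O.sigmaM.image fun m => plug c (q ++ m))

open Classical in
/-- The items `(i, q, m)` with `q ∈ Q i` and `m ∈ S`. -/
noncomputable def items (O : Obs t) (S : Finset (List (Hat t))) :
    Finset (Option (Call t) × List (Hat t) × List (Hat t)) :=
  Finset.univ.biUnion fun i => (O.Q i ×ˢ S).image fun p => (i, p)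

open Classical in
/-- The items to put on the work list when `q` is added to module `i` of `O`. -/
noncomputable def newItems (O : Obs t) (i : Option (Call t)) (q : List (Hat t)) :
    Finset (Option (Call t) × List (Hat t) × List (Hat t)) :=
  (O.sigmaM.image fun m => (i, q, m)) ∪
    match i with
    | none => ∅
    | some a => (O.addState i q).items (nested a q)

open Classical in
/-- The data before the first step. -/
noncomputable def initial (t : A → Kind) : Obs t where
  Q _ := {[]}
  C
    | none => {([], [])}
    | some a => Finset.univ.image fun b : Ret t => ([.call a], [.ret b])
  nil_mem := by simp
  memo _ := none

end Obs

/-- The control states of the learner: in the loop that closes the table (`W` is the work list;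
in `checking`, the item `(i, q, m)` has been taken from it), about to ask an equivalence query, in
the binary search for a position in the counterexample `s` (between `lo` and `hi`), finished. -/
inductive VState (t : A → Kind) : Type u
  | closing (O : Obs t) (W : Finset (Option (Call t) × List (Hat t) × List (Hat t)))
  | checking (O : Obs t) (W : Finset (Option (Call t) × List (Hat t) × List (Hat t)))
      (i : Option (Call t)) (q m : List (Hat t))
  | asking (O : Obs t)
  | searching (O : Obs t) (s : List (Hat t)) (lo hi : ℕ)
  | done (O : Obs t)

variable [Fintype A]

/-- Membership queries for the strings in `F` that are not in the table yet. -/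
noncomputable def ask (O : Obs t) (F : Finset (List A)) (k : Obs t → VState t) :
    Action A (KSEVPA (Call t) (Ret t) (Plain t)) (VState t) :=
  .memb (O.missing F) fun ans => k (O.record (O.missing F) ans)

/-- Entering the loop that closes the table. -/
noncomputable def startClosing (O : Obs t) : VState t := .closing O (O.items O.sigmaM)

open Classical in
/-- The steps of the learner. -/
noncomputable def act : VState t → Action A (KSEVPA (Call t) (Ret t) (Plain t)) (VState t)
  | .closing O W =>
      if W = ∅ then ask O O.table .asking
      else .goto {S | ∃ x ∈ W, S = .checking O (W.erase x) x.1 x.2.1 x.2.2}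
  | .checking O W i q m =>
      ask O (O.tests i (q ++ m)) fun O' =>
        if ∃ q' ∈ O'.Q i, O'.Equiv i (q ++ m) q' then .closing O' W
        else .closing (O'.addState i (q ++ m)) (W ∪ O'.newItems i (q ++ m))
  | .asking O =>
      .equiv O.construct fun
        | none => .done O
        | some s => .searching O (s.map (tag t)) 0 s.length
  | .searching O s lo hi =>
      if lo + 1 < hi then
        .memb {O.contextString s ((lo + hi) / 2)} fun ans =>
          -- `s` is a counterexample: it is in the target language iff the hypothesis rejects it
          if ans ⟨_, Finset.mem_singleton_self _⟩ = true ↔ ¬ O.construct.Accepts s then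
            .searching O s ((lo + hi) / 2) hi
          else .searching O s lo ((lo + hi) / 2)
      else .goto {startClosing (O.update s lo)}
  | .done O => .halt O.construct

/-- The table-based learner for a known tagging `t`. -/
noncomputable def learner (t : A → Kind) :
    Learner A (KSEVPA (Call t) (Ret t) (Plain t)) where
  State := VState t
  start := startClosing (Obs.initial t)
  act := act

/-- The strings whose tagged version is accepted by an automaton. -/
def untaggedLanguage (t : A → Kind) (H : KSEVPA (Call t) (Ret t) (Plain t)) : Language A :=
  {s | H.Accepts (s.map (tag t))}

end Algorithm

end VStar

open VStar

/-! Minimality comes from separation. In any automaton `N` for the tagged language, the state that a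
well-matched word reaches from the entry of a module decides all tests of that module: the left part
of a test is empty or ends in the call that enters the module (`KSEVPA.run_congr`). The invariant
`Obs.Sound` keeps the access words of a module pairwise separated by its tests, so sending a word to
the state it reaches in `N` is injective. Every table is thus a lower bound for every automaton, and
a hypothesis that recognizes the language is minimal. If `N` is no larger, the injection is a
bijection, and closedness makes it an isomorphism (`Obs.Ready.iso`).

Progress comes from counterexamples. The context string at the start of a counterexample is the
counterexample itself; at the end it is the access word of the last state, whose membership is what
the hypothesis answers. The two disagree, so membership changes at some symbol. There the access
word of the target state replaces a word with the same tests, and the context is a test that tells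
them apart (`Obs.Ready.sound_update`). The number of words stays bounded, since well-matched words
act on the finitely many relevant nonterminals in finitely many ways (`exists_finite_signature`). No
automaton has to be known beforehand; a lexicographic rank then decreases at every step.

For the counts, each counterexample yields a new word. A membership query either fills a new entry
of the table, whose size is bounded by `Obs.Sound.card_table_le`, or belongs to a binary search,
which costs `Nat.clog 2` of the length. -/

namespace VStar

/-! ### Runs of automata on well-matched words -/

section Words

variable {C R P : Type u}

/-- Well-matched words, in which every call has a matching return and vice versa. -/
inductive WellMatched : List (Sym C R P) → Prop
  | nil : WellMatched []
  | plain {w} (c : P) : WellMatched w → WellMatched (w ++ [.plain c])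
  | nest {w v} (a : C) (b : R) : WellMatched w → WellMatched v →
      WellMatched (w ++ ([.call a] ++ v ++ [.ret b]))

namespace KSEVPA

/-- The stacks with which the automaton can be in a given module. -/
def ValidStack (M : KSEVPA C R P) : Option C → List M.State → Prop
  | none, st => st = []
  | some _, [] => False
  | some _, ⟨j, _⟩ :: st => M.ValidStack j st

theorem step_validStack (M : KSEVPA C R P) {i : Option C} {q : M.Q i} {st : List M.State}
    {x : Sym C R P} {j : Option C} {p : M.Q j} {st' : List M.State}
    (h : M.ValidStack i st) (hs : M.step (⟨i, q⟩, st) x = some (⟨j, p⟩, st')) :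
    M.ValidStack j st' := by
  cases x with
  | call a =>
    simp only [step, Option.some.injEq, Prod.mk.injEq] at hs
    obtain ⟨h1, rfl⟩ := hs
    cases h1
    exact h
  | plain c =>
    simp only [step, Option.some.injEq, Prod.mk.injEq] at hs
    obtain ⟨h1, rfl⟩ := hs
    cases h1
    exact h
  | ret b =>
    cases i with
    | none => simp [step] at hs
    | some a =>
      cases st with
      | nil => simp [step] at hs
      | cons p' st =>
        obtain ⟨j', q'⟩ := p'
        simp only [step, Option.some.injEq, Prod.mk.injEq] at hs
        obtain ⟨h1, rfl⟩ := hs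
        cases h1
        exact h

theorem foldlM_validStack (M : KSEVPA C R P) (w : List (Sym C R P)) :
    ∀ {i : Option C} {q : M.Q i} {st : List M.State} {j : Option C} {p : M.Q j}
      {st' : List M.State}, M.ValidStack i st →
      w.foldlM M.step (⟨i, q⟩, st) = some (⟨j, p⟩, st') → M.ValidStack j st' := by
  induction w with
  | nil =>
    intro i q st j p st' h hs
    simp only [List.foldlM_nil, Option.pure_def, Option.some.injEq, Prod.mk.injEq] at hs
    obtain ⟨h1, rfl⟩ := hs
    cases h1
    exact h
  | cons x w ih =>
    intro i q st j p st' h hs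
    rw [List.foldlM_cons] at hs
    obtain ⟨⟨⟨i', q'⟩, st1⟩, h1, h2⟩ := Option.bind_eq_some_iff.1 hs
    exact ih (M.step_validStack h h1) h2

theorem run_validStack (M : KSEVPA C R P) {w : List (Sym C R P)} {j : Option C} {p : M.Q j}
    {st : List M.State} (h : M.run w = some (⟨j, p⟩, st)) : M.ValidStack j st :=
  M.foldlM_validStack w (i := none) (st := []) rfl h

/-- The order of the quantifiers matters: a well-matched word never looks below its own calls, so
the resulting state is independent of the stack. -/
theorem exists_foldlM_wellMatched (M : KSEVPA C R P) {w : List (Sym C R P)}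
    (hw : WellMatched w) : ∀ (i : Option C) (q : M.Q i), ∃ q' : M.Q i, ∀ st : List M.State,
      w.foldlM M.step (⟨i, q⟩, st) = some (⟨i, q'⟩, st) := by
  induction hw with
  | nil => exact fun i q => ⟨q, fun st => rfl⟩
  | plain c _ ih =>
    intro i q
    obtain ⟨q', h⟩ := ih i q
    exact ⟨M.onPlain i q' c, fun st => by simp [List.foldlM_append, h, step]⟩
  | nest a b _ _ ih₁ ih₂ =>
    intro i q
    obtain ⟨q', h⟩ := ih₁ i q
    obtain ⟨p, h'⟩ := ih₂ (some a) (M.entry (some a))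
    exact ⟨M.onRet a p b i q', fun st => by simp [List.foldlM_append, h, h', step]⟩

open Classical in
/-- The state of module `i` that a well-matched word leads to from the entry of the module. -/
noncomputable def reach (M : KSEVPA C R P) (i : Option C) (w : List (Sym C R P)) : M.Q i :=
  if hw : WellMatched w then (M.exists_foldlM_wellMatched hw i (M.entry i)).choose else M.entry i

theorem foldlM_reach (M : KSEVPA C R P) {w : List (Sym C R P)} (hw : WellMatched w)
    (i : Option C) (st : List M.State) :
    w.foldlM M.step (⟨i, M.entry i⟩, st) = some (⟨i, M.reach i w⟩, st) := by
  rw [reach, dif_pos hw]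
  exact (M.exists_foldlM_wellMatched hw i (M.entry i)).choose_spec st

theorem reach_eq_of_foldlM (M : KSEVPA C R P) {w : List (Sym C R P)} (hw : WellMatched w)
    {i : Option C} {q : M.Q i}
    (h : w.foldlM M.step (⟨i, M.entry i⟩, []) = some (⟨i, q⟩, [])) : M.reach i w = q := by
  have h' := (M.foldlM_reach hw i []).symm.trans h
  simpa using h'

theorem reach_nil (M : KSEVPA C R P) (i : Option C) : M.reach i [] = M.entry i :=
  M.reach_eq_of_foldlM .nil rfl

theorem reach_plain (M : KSEVPA C R P) {w : List (Sym C R P)} (hw : WellMatched w)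
    (i : Option C) (c : P) : M.reach i (w ++ [.plain c]) = M.onPlain i (M.reach i w) c :=
  M.reach_eq_of_foldlM (.plain c hw) (by simp [List.foldlM_append, M.foldlM_reach hw, step])

theorem reach_nest (M : KSEVPA C R P) {w v : List (Sym C R P)} (hw : WellMatched w)
    (hv : WellMatched v) (i : Option C) (a : C) (b : R) :
    M.reach i (w ++ ([.call a] ++ v ++ [.ret b])) =
      M.onRet a (M.reach (some a) v) b i (M.reach i w) :=
  M.reach_eq_of_foldlM (.nest a b hw hv)
    (by simp [List.foldlM_append, M.foldlM_reach hw, M.foldlM_reach hv, step])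

theorem accepts_iff_reach (M : KSEVPA C R P) {w : List (Sym C R P)} (hw : WellMatched w) :
    M.Accepts w ↔ M.reach none w ∈ M.final := by
  simp only [Accepts, run, M.foldlM_reach hw]
  constructor
  · rintro ⟨q, hq, h⟩
    have : M.reach none w = q := by simpa using h
    exact this ▸ hq
  · exact fun h => ⟨_, h, rfl⟩

end KSEVPA

/-- The left contexts in which the words of a module are tested. -/
def LeftShape : Option C → List (Sym C R P) → Prop
  | none, l => l = []
  | some a, l => ∃ l', l = l' ++ [.call a]

/-- This is where single entries count: whatever precedes the call `a` at the end of `l`, the word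
`u` starts at the entry of module `a`, so `reach` captures all that the rest of the run can see of
it. -/
theorem KSEVPA.run_congr (M : KSEVPA C R P) {i : Option C} {l u v : List (Sym C R P)}
    (hl : LeftShape i l) (hu : WellMatched u) (hv : WellMatched v)
    (h : M.reach i u = M.reach i v) (r : List (Sym C R P)) :
    M.run (l ++ u ++ r) = M.run (l ++ v ++ r) := by
  cases i with
  | none =>
    cases hl
    simp only [run, List.nil_append, List.foldlM_append, M.foldlM_reach hu, M.foldlM_reach hv, h]
  | some a =>
    obtain ⟨l, rfl⟩ := hl
    simp only [run, List.foldlM_append]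
    cases l.foldlM M.step (⟨none, M.entry none⟩, []) with
    | none => rfl
    | some x =>
      simp [step, M.foldlM_reach hu, M.foldlM_reach hv, h]

theorem KSEVPA.accepts_congr (M : KSEVPA C R P) {i : Option C} {l u v : List (Sym C R P)}
    (hl : LeftShape i l) (hu : WellMatched u) (hv : WellMatched v)
    (h : M.reach i u = M.reach i v) (r : List (Sym C R P)) :
    M.Accepts (l ++ u ++ r) ↔ M.Accepts (l ++ v ++ r) := by
  simp only [Accepts, M.run_congr hl hu hv h r]

end Words

/-! ### Visibly pushdown grammars and their finitely many word classes -/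

section Grammar

/-- Leftmost derivations of words from sentential forms. -/
inductive Parse {T : Type u} (g : ContextFreeGrammar.{u} T) :
    List (Symbol T g.NT) → List T → Prop
  | nil : Parse g [] []
  | terminal {α w} (x : T) : Parse g α w → Parse g (.terminal x :: α) (x :: w)
  | rule {α w r} : r ∈ g.rules → Parse g (r.output ++ α) w →
      Parse g (.nonterminal r.input :: α) w

theorem Parse.of_terminals {T : Type u} (g : ContextFreeGrammar.{u} T) (w : List T) :
    Parse g (w.map .terminal) w := by
  induction w with
  | nil => exact .nil
  | cons x w ih => exact .terminal x ih

/-- A rewriting at an arbitrary position can be postponed until its nonterminal is leftmost; this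
turns arbitrary derivations into leftmost ones. -/
theorem Parse.of_rewrites {T : Type u} {g : ContextFreeGrammar.{u} T} {r} (hr : r ∈ g.rules)
    {β : List (Symbol T g.NT)} {w : List T} (h : Parse g β w) :
    ∀ p q, β = p ++ r.output ++ q → Parse g (p ++ [.nonterminal r.input] ++ q) w := by
  induction h with
  | nil =>
    intro p q hβ
    have hβ' := hβ.symm
    simp only [List.append_eq_nil_iff] at hβ'
    obtain ⟨⟨rfl, ho⟩, rfl⟩ := hβ'
    exact .rule hr (by simpa [ho] using Parse.nil)
  | @terminal α w x hα ih =>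
    intro p q hβ
    cases p with
    | nil =>
      refine .rule hr ?_
      rw [List.nil_append] at hβ
      exact hβ ▸ hα.terminal x
    | cons y p =>
      simp only [List.cons_append, List.cons.injEq] at hβ
      obtain ⟨rfl, hβ⟩ := hβ
      exact .terminal x (ih p q hβ)
  | @rule α w r' hr' hα ih =>
    intro p q hβ
    cases p with
    | nil =>
      refine .rule hr ?_
      rw [List.nil_append] at hβ
      exact hβ ▸ hα.rule hr'
    | cons y p =>
      simp only [List.cons_append, List.cons.injEq] at hβ
      obtain ⟨rfl, hβ⟩ := hβ
      exact .rule hr' (by simpa using ih (r'.output ++ p) q (by simp [hβ]))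

theorem Parse.of_derives {T : Type u} {g : ContextFreeGrammar.{u} T} {α : List (Symbol T g.NT)}
    {w : List T} (h : g.Derives α (w.map .terminal)) : Parse g α w := by
  induction h using Relation.ReflTransGen.head_induction_on with
  | refl => exact .of_terminals g w
  | head h _ ih =>
    obtain ⟨r, hr, hrw⟩ := h
    obtain ⟨p, q, rfl, rfl⟩ := hrw.exists_parts
    exact ih.of_rewrites hr p q rfl

variable {C R P : Type u} (g : ContextFreeGrammar.{u} (Sym C R P))

/-- `N → ε` is a rule. -/
def RuleNil (N : g.NT) : Prop := (⟨N, []⟩ : ContextFreeRule _ _) ∈ g.rules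

/-- `N → c N₁` is a rule. -/
def RulePlain (N : g.NT) (c : P) (N₁ : g.NT) : Prop :=
  (⟨N, [.terminal (.plain c), .nonterminal N₁]⟩ : ContextFreeRule _ _) ∈ g.rules

/-- `N → a N₁ b N₂` is a rule. -/
def RuleNest (N : g.NT) (a : C) (N₁ : g.NT) (b : R) (N₂ : g.NT) : Prop :=
  (⟨N, [.terminal (.call a), .nonterminal N₁, .terminal (.ret b), .nonterminal N₂]⟩ :
    ContextFreeRule _ _) ∈ g.rules

/-- The leftmost derivations of a word from a nonterminal that is followed by a stack of pending
return symbols and nonterminals. -/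
def Derivable : g.NT → List (R × g.NT) → List (Sym C R P) → Prop
  | N, st, [] => RuleNil g N ∧ st = []
  | N, st, .plain c :: w => ∃ N₁, RulePlain g N c N₁ ∧ Derivable N₁ st w
  | N, st, .call a :: w => ∃ N₁ b N₂, RuleNest g N a N₁ b N₂ ∧ Derivable N₁ ((b, N₂) :: st) w
  | N, st, .ret b :: w => RuleNil g N ∧ ∃ N₂ st', st = (b, N₂) :: st' ∧ Derivable N₂ st' w

/-- The sentential form of a stack. -/
def stackForm (st : List (R × g.NT)) : List (Symbol (Sym C R P) g.NT) :=
  st.flatMap fun x => [.terminal (.ret x.1), .nonterminal x.2]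

variable {g}

/-- The three rule forms preserve the shape of a nonterminal followed by pairs of a return symbol
and a nonterminal, except that `N → ε` uncovers the next return symbol. -/
theorem Derivable.of_parse (hg : IsVPG g) (w : List (Sym C R P)) :
    ∀ N st, Parse g (.nonterminal N :: stackForm g st) w → Derivable g N st w := by
  induction w with
  | nil =>
    intro N st h
    cases h with
    | @rule _ _ r hr h =>
      obtain ⟨N, o⟩ := r
      obtain rfl | ⟨c, N₁, rfl⟩ | ⟨a, N₁, b, N₂, rfl⟩ := hg _ hr
      · refine ⟨hr, ?_⟩
        cases st with
        | nil => rfl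
        | cons x st => simp only [stackForm, List.flatMap_cons] at h; cases h
      · cases h
      · cases h
  | cons x w ih =>
    intro N st h
    cases h with
    | @rule _ _ r hr h =>
      obtain ⟨N, o⟩ := r
      obtain ho | ⟨c, N₁, ho⟩ | ⟨a, N₁, b, N₂, ho⟩ := hg _ hr <;>
        simp only at ho <;> subst ho
      · cases st with
        | nil => cases h
        | cons y st =>
          simp only [stackForm, List.flatMap_cons] at h
          cases h with
          | terminal _ h => exact ⟨hr, _, _, rfl, ih _ _ h⟩
      · cases h with
        | terminal _ h => exact ⟨_, hr, ih _ _ h⟩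
      · cases h with
        | terminal _ h => exact ⟨_, _, _, hr, ih _ ((b, N₂) :: st) h⟩

theorem Derivable.derives (w : List (Sym C R P)) :
    ∀ N st, Derivable g N st w →
      g.Derives (.nonterminal N :: stackForm g st) (w.map .terminal) := by
  induction w with
  | nil =>
    rintro N st ⟨h, rfl⟩
    exact .single ⟨_, h, .head _⟩
  | cons x w ih =>
    intro N st h
    have key : ∀ {α : List (Symbol (Sym C R P) g.NT)}, g.Derives α (w.map .terminal) →
        g.Derives (.terminal x :: α) ((x :: w).map .terminal) :=
      fun h => ContextFreeGrammar.Derives.append_left h [.terminal x]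
    cases x with
    | plain c =>
      obtain ⟨N₁, h₁, h₂⟩ := h
      exact .head ⟨_, h₁, .head _⟩ (key (ih _ _ h₂))
    | call a =>
      obtain ⟨N₁, b, N₂, h₁, h₂⟩ := h
      exact .head ⟨_, h₁, .head _⟩ (key (ih _ _ h₂))
    | ret b =>
      obtain ⟨h₁, N₂, st', rfl, h₂⟩ := h
      exact .head ⟨_, h₁, .head _⟩ (key (ih _ _ h₂))

theorem mem_language_iff_derivable (hg : IsVPG g) (w : List (Sym C R P)) :
    w ∈ g.language ↔ Derivable g g.initial [] w :=
  ⟨fun h => .of_parse hg w _ [] (.of_derives h), fun h => h.derives w _ []⟩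

theorem Derivable.exists_rule {w : List (Sym C R P)} {N : g.NT} {st : List (R × g.NT)}
    (h : Derivable g N st w) : ∃ r ∈ g.rules, r.input = N := by
  rcases w with _ | ⟨_ | _ | _, w⟩
  · exact ⟨_, h.1, rfl⟩
  · obtain ⟨N₁, b, N₂, h, -⟩ := h
    exact ⟨_, h, rfl⟩
  · exact ⟨_, h.1, rfl⟩
  · obtain ⟨N₁, h, -⟩ := h
    exact ⟨_, h, rfl⟩

/-- Grammar stack and automaton stack have the same height throughout, so no return finds an empty
stack; an empty valid stack at the end forces the base module. Any automaton can thus reject a word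
of the language only by its final states. -/
theorem exists_run_of_derivable (M : KSEVPA C R P) (w : List (Sym C R P)) :
    ∀ (N : g.NT) (st : List (R × g.NT)), Derivable g N st w →
      ∀ (i : Option C) (q : M.Q i) (sM : List M.State), M.ValidStack i sM →
      sM.length = st.length → ∃ q', w.foldlM M.step (⟨i, q⟩, sM) = some (⟨none, q'⟩, []) := by
  induction w with
  | nil =>
    rintro N st ⟨-, rfl⟩ i q sM hv hl
    obtain rfl : sM = [] := by simpa using hl
    cases i with
    | none => exact ⟨q, rfl⟩
    | some a => exact hv.elim
  | cons x w ih =>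
    intro N st h i q sM hv hl
    cases x with
    | plain c =>
      obtain ⟨N₁, -, h⟩ := h
      exact ih _ _ h i (M.onPlain i q c) sM hv hl
    | call a =>
      obtain ⟨N₁, b, N₂, -, h⟩ := h
      exact ih _ _ h (some a) (M.entry _) (⟨i, q⟩ :: sM) hv (by simp [hl])
    | ret b =>
      obtain ⟨-, N₂, st', rfl, h⟩ := h
      rcases sM with _ | ⟨⟨j, q'⟩, sM⟩
      · simp at hl
      · cases i with
        | none => cases hv
        | some a => exact ih _ _ h j (M.onRet a q b j q') sM hv (by simpa using hl)

/-- The action of a well-matched word on the nonterminals, as far as it matters. -/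
theorem exists_wellMatched_relation {u : List (Sym C R P)} (hu : WellMatched u) :
    ∃ T : g.NT → g.NT → Prop, ∀ N st w,
      Derivable g N st (u ++ w) ↔ ∃ N', T N N' ∧ Derivable g N' st w := by
  induction hu with
  | nil => exact ⟨Eq, fun N st w => by simp⟩
  | plain c _ ih =>
    obtain ⟨T, hT⟩ := ih
    refine ⟨fun N N' => ∃ N₁, T N N₁ ∧ RulePlain g N₁ c N', fun N st w => ?_⟩
    rw [List.append_assoc, hT]
    simp only [List.singleton_append, Derivable]
    grind
  | nest a b _ _ ih₁ ih₂ =>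
    obtain ⟨T₁, hT₁⟩ := ih₁
    obtain ⟨T₂, hT₂⟩ := ih₂
    -- What the inner word leaves, `N₃`, must be erased before the pending `b` can be read.
    refine ⟨fun N N' => ∃ N₁ N₂ N₃, T₁ N N₁ ∧ RuleNest g N₁ a N₂ b N' ∧ T₂ N₂ N₃ ∧ RuleNil g N₃,
      fun N st w => ?_⟩
    rw [List.append_assoc, hT₁]
    simp only [List.cons_append, List.nil_append, List.append_assoc, Derivable, hT₂]
    grind

open Classical in
/-- Well-matched words fall into finitely many classes with respect to a visibly pushdown
language. -/
theorem exists_finite_signature (hg : IsVPG g) :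
    ∃ (κ : Type) (_ : Finite κ) (sig : List (Sym C R P) → κ), ∀ u v, WellMatched u →
      WellMatched v → sig u = sig v → ∀ l r, l ++ u ++ r ∈ g.language → l ++ v ++ r ∈ g.language := by
  -- The type of nonterminals may be infinite, but only left sides of rules can derive a word.
  let S : Type := {N : g.NT // N ∈ g.rules.image fun r => r.input}
  have : Finite S := inferInstanceAs (Finite {N : g.NT // N ∈ g.rules.image fun r => r.input})
  have hS : ∀ {w : List (Sym C R P)} {N st}, Derivable g N st w →
      N ∈ g.rules.image fun r => r.input := fun h => by
    simpa using h.exists_rule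
  let sig : List (Sym C R P) → Set (S × S) := fun u =>
    if hu : WellMatched u then
      {p | (exists_wellMatched_relation (g := g) hu).choose p.1.1 p.2.1}
    else ∅
  refine ⟨Set (S × S), inferInstance, sig, fun u v hu hv huv l r => ?_⟩
  rw [mem_language_iff_derivable hg, mem_language_iff_derivable hg]
  have hTu := (exists_wellMatched_relation (g := g) hu).choose_spec
  have hTv := (exists_wellMatched_relation (g := g) hv).choose_spec
  simp only [sig, dif_pos hu, dif_pos hv] at huv
  suffices ∀ N st, Derivable g N st (l ++ u ++ r) → Derivable g N st (l ++ v ++ r) from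
    this _ _
  induction l with
  | nil =>
    intro N st h
    obtain ⟨N', h₁, h₂⟩ := (hTu N st r).1 h
    refine (hTv N st r).2 ⟨N', ?_, h₂⟩
    have h₃ : ((⟨N, hS h⟩, ⟨N', hS h₂⟩) : S × S) ∈
        {p : S × S | (exists_wellMatched_relation (g := g) hu).choose p.1.1 p.2.1} := h₁
    rw [huv] at h₃
    exact h₃
  | cons x l ih =>
    intro N st h
    cases x with
    | plain c =>
      obtain ⟨N₁, h₁, h₂⟩ := h
      exact ⟨N₁, h₁, ih _ _ h₂⟩
    | call a =>
      obtain ⟨N₁, b, N₂, h₁, h₂⟩ := h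
      exact ⟨N₁, b, N₂, h₁, ih _ _ h₂⟩
    | ret b =>
      obtain ⟨h₁, N₂, st', h₂, h₃⟩ := h
      exact ⟨h₁, N₂, st', h₂, ih _ _ h₃⟩

theorem exists_run_of_mem_language (hg : IsVPG g) {w : List (Sym C R P)} (hw : w ∈ g.language)
    (M : KSEVPA C R P) : ∃ q, M.run w = some (⟨none, q⟩, []) :=
  exists_run_of_derivable M w _ _ ((mem_language_iff_derivable hg w).1 hw) none _ [] rfl rfl

end Grammar

/-! ### Tagging and tests -/

section Tags

variable {A : Type u} {t : A → Kind}

theorem untag_tag (a : A) : untag (tag t a) = a := by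
  unfold tag
  split <;> rfl

theorem tag_untag (x : Hat t) : tag t (untag x) = x := by
  rcases x with ⟨a, h⟩ | ⟨a, h⟩ | ⟨a, h⟩ <;> simp only [untag] <;> unfold tag <;>
    split <;> rename_i h' <;> first | rfl | cases h.symm.trans h'

theorem map_untag_map_tag (s : List A) : (s.map (tag t)).map untag = s := by
  simp [Function.comp_def, untag_tag]

theorem map_tag_map_untag (w : List (Hat t)) : (w.map untag).map (tag t) = w := by
  simp [Function.comp_def, tag_untag]

theorem mem_taggedLanguage_iff {L : Language A} {w : List (Hat t)} :
    w ∈ taggedLanguage t L ↔ w.map untag ∈ L := by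
  constructor
  · rintro ⟨s, hs, rfl⟩
    rwa [map_untag_map_tag]
  · exact fun h => ⟨_, h, map_tag_map_untag w⟩

theorem plug_mem_iff {L : Language A} {c : List (Hat t) × List (Hat t)} {q : List (Hat t)} :
    plug c q ∈ L ↔ c.1 ++ q ++ c.2 ∈ taggedLanguage t L :=
  mem_taggedLanguage_iff.symm

theorem plug_append_right (l r q m : List (Hat t)) : plug (l, m ++ r) q = plug (l, r) (q ++ m) := by
  simp [plug]

end Tags

/-- The words `u` and `v` pass the same tests in `C`. -/
def TestEquiv {A : Type u} {t : A → Kind} (L : Language A)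
    (C : Finset (List (Hat t) × List (Hat t))) (u v : List (Hat t)) : Prop :=
  ∀ c ∈ C, (plug c u ∈ L ↔ plug c v ∈ L)

namespace TestEquiv

variable {A : Type u} {t : A → Kind} {L : Language A} {C : Finset (List (Hat t) × List (Hat t))}
  {x y z : List (Hat t)}

theorem refl (x : List (Hat t)) : TestEquiv L C x x := fun _ _ => Iff.rfl

theorem symm (h : TestEquiv L C x y) : TestEquiv L C y x := fun c hc => (h c hc).symm

theorem trans (h : TestEquiv L C x y) (h' : TestEquiv L C y z) : TestEquiv L C x z :=
  fun c hc => (h c hc).trans (h' c hc)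

theorem mono {C' : Finset (List (Hat t) × List (Hat t))} (hC : C ⊆ C') (h : TestEquiv L C' x y) :
    TestEquiv L C x y := fun c hc => h c (hC hc)

theorem of_reach {i : Option (Call t)} {N : KSEVPA (Call t) (Ret t) (Plain t)}
    (hN : N.Recognizes (taggedLanguage t L)) (hC : ∀ c ∈ C, LeftShape i c.1)
    (hx : WellMatched x) (hy : WellMatched y) (h : N.reach i x = N.reach i y) :
    TestEquiv L C x y := fun c hc => by
  rw [plug_mem_iff, plug_mem_iff, ← hN, ← hN]
  exact N.accepts_congr (hC c hc) hx hy h c.2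

end TestEquiv

/-! ### The stored answers and the table -/

namespace Obs

section Basic

variable {A : Type u} {t : A → Kind}

/-- Two missing answers would compare as equal, hence the requirement that all tests of both words
be stored. -/
theorem equiv_iff {L : Language A} {O : Obs t}
    (hO : ∀ w b, O.memo w = some b → (b = true ↔ w ∈ L)) {i : Option (Call t)}
    {x y : List (Hat t)} (hx : ∀ c ∈ O.C i, O.memo (plug c x) ≠ none)
    (hy : ∀ c ∈ O.C i, O.memo (plug c y) ≠ none) :
    O.Equiv i x y ↔ TestEquiv L (O.C i) x y := by
  refine forall₂_congr fun c hc => ?_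
  obtain ⟨b, hb⟩ := Option.ne_none_iff_exists'.1 (hx c hc)
  obtain ⟨b', hb'⟩ := Option.ne_none_iff_exists'.1 (hy c hc)
  rw [hb, hb', ← hO _ _ hb, ← hO _ _ hb', Option.some.injEq, Bool.eq_iff_iff]

theorem mem_missing {O : Obs t} {F : Finset (List A)} {w : List A} :
    w ∈ O.missing F ↔ w ∈ F ∧ O.memo w = none := by
  simp [missing]

open Classical in
/-- The data after the membership queries for `F`. -/
noncomputable def answer (O : Obs t) (L : Language A) (F : Finset (List A)) : Obs t :=
  O.record (O.missing F) fun w => decide (w.1 ∈ L)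

theorem memo_answer (O : Obs t) (L : Language A) (F : Finset (List A)) (w : List A) :
    (w ∈ F ∧ O.memo w = none ∧ ∃ b, (b = true ↔ w ∈ L) ∧ (O.answer L F).memo w = some b) ∨
      ((w ∈ F → O.memo w ≠ none) ∧ (O.answer L F).memo w = O.memo w) := by
  by_cases h : w ∈ O.missing F
  · have h' := mem_missing.1 h
    exact .inl ⟨h'.1, h'.2, @decide (w ∈ L) (Classical.propDecidable _), by simp,
      by simp [answer, record, h]⟩
  · exact .inr ⟨fun h₁ h₂ => h (mem_missing.2 ⟨h₁, h₂⟩), by simp [answer, record, h]⟩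

theorem memo_answer_ne_none (O : Obs t) (L : Language A) {F : Finset (List A)} {w : List A}
    (hw : w ∈ F) : (O.answer L F).memo w ≠ none := by
  rcases O.memo_answer L F w with ⟨-, -, b, -, h⟩ | ⟨h, h'⟩
  · simp [h]
  · exact h' ▸ h hw

theorem mem_Q_addState {O : Obs t} {i j : Option (Call t)} {q p : List (Hat t)} :
    p ∈ (O.addState i q).Q j ↔ p ∈ O.Q j ∨ j = i ∧ p = q := by
  simp only [addState]
  by_cases h : j = i
  · subst h
    simp [or_comm]
  · simp [h]

theorem leftShape_leftContext (O : Obs t) {i : Option (Call t)} {st : List O.construct.State}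
    (h : O.construct.ValidStack i st) : LeftShape i (O.leftContext i st) := by
  rcases i with _ | a
  · simp [leftContext, LeftShape]
  · rcases st with _ | ⟨⟨j, q⟩, st⟩
    · exact h.elim
    · exact ⟨_, by rw [leftContext]⟩

end Basic

variable {A : Type u} {t : A → Kind} [Fintype A]

theorem mem_sigmaM {O : Obs t} {m : List (Hat t)} :
    m ∈ O.sigmaM ↔ (∃ c : Plain t, m = [.plain c]) ∨
      ∃ (a : Call t) (q : List (Hat t)) (b : Ret t),
        q ∈ O.Q (some a) ∧ m = [.call a] ++ q ++ [.ret b] := by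
  simp only [sigmaM, nested, Finset.mem_union, Finset.mem_image, Finset.mem_univ, true_and,
    Finset.mem_biUnion]
  grind

theorem mem_table {O : Obs t} {w : List A} :
    w ∈ O.table ↔ (∃ q ∈ O.Q none, w = q.map untag) ∨
      ∃ i, ∃ c ∈ O.C i, ∃ q ∈ O.Q i, w = plug c q ∨ ∃ m ∈ O.sigmaM, w = plug c (q ++ m) := by
  simp only [table, Finset.mem_union, Finset.mem_image, Finset.mem_univ, true_and,
    Finset.mem_biUnion, Finset.mem_insert]
  grind

theorem mem_items {O : Obs t} {S : Finset (List (Hat t))} {i : Option (Call t)}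
    {q m : List (Hat t)} : (i, q, m) ∈ O.items S ↔ q ∈ O.Q i ∧ m ∈ S := by
  simp only [items, Finset.mem_biUnion, Finset.mem_univ, true_and, Finset.mem_image,
    Finset.mem_product, Prod.exists, Prod.mk.injEq]
  grind

theorem sigmaM_mono {O O' : Obs t} (hQ : ∀ i, O.Q i ⊆ O'.Q i) : O.sigmaM ⊆ O'.sigmaM := by
  intro m hm
  rw [mem_sigmaM] at hm ⊢
  exact hm.imp_right fun ⟨a, q, b, hq, h⟩ => ⟨a, q, b, hQ _ hq, h⟩

theorem table_mono {O O' : Obs t} (hQ : ∀ i, O.Q i ⊆ O'.Q i) (hC : ∀ i, O.C i ⊆ O'.C i) :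
    O.table ⊆ O'.table := by
  intro w hw
  rw [mem_table] at hw ⊢
  rcases hw with ⟨q, hq, h⟩ | ⟨i, c, hc, q, hq, h⟩
  · exact .inl ⟨q, hQ _ hq, h⟩
  · exact .inr ⟨i, c, hC _ hc, q, hQ _ hq,
      h.imp_right fun ⟨m, hm, h⟩ => ⟨m, sigmaM_mono hQ hm, h⟩⟩

theorem tests_subset_table {O : Obs t} {i : Option (Call t)} {q m : List (Hat t)}
    (hq : q ∈ O.Q i) (hm : m ∈ O.sigmaM) : O.tests i (q ++ m) ⊆ O.table := by
  intro w hw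
  simp only [tests, Finset.mem_biUnion, Finset.mem_image, Finset.mem_insert] at hw
  obtain ⟨c, hc, p, rfl | hp, rfl⟩ := hw
  · exact mem_table.2 (.inr ⟨i, c, hc, q, hq, .inr ⟨m, hm, rfl⟩⟩)
  · exact mem_table.2 (.inr ⟨i, c, hc, p, hp, .inl rfl⟩)

open Classical in
/-- The number of access words. -/
noncomputable def numWords (O : Obs t) : ℕ := ∑ i, (O.Q i).card

theorem size_construct (O : Obs t) : O.construct.size = O.numWords := by
  classical
  change Nat.card ((i : Option (Call t)) × {q // q ∈ O.Q i}) = _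
  rw [Nat.card_sigma, numWords]
  simp

open Classical in
/-- The strings of the table with a stored answer. -/
noncomputable def known (O : Obs t) : Finset (List A) := O.table.filter fun w => O.memo w ≠ none

theorem known_card_mono {O O' : Obs t} (hQ : ∀ i, O.Q i ⊆ O'.Q i) (hC : ∀ i, O.C i ⊆ O'.C i)
    (hm : O'.memo = O.memo) : O.known.card ≤ O'.known.card := by
  refine Finset.card_le_card fun w hw => ?_
  simp only [known, Finset.mem_filter, hm] at hw ⊢
  exact ⟨table_mono hQ hC hw.1, hw.2⟩

/-- The strings asked are new and lie in the table, so each query is paid for by one more known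
entry. This reduces counting table queries to bounding the table. -/
theorem card_known_answer (O : Obs t) (L : Language A) {F : Finset (List A)} (hF : F ⊆ O.table) :
    (O.answer L F).known.card = O.known.card + (O.missing F).card := by
  classical
  rw [← Finset.card_union_of_disjoint]
  · congr 1
    ext w
    have htab : (O.answer L F).table = O.table := rfl
    simp only [known, Finset.mem_filter, Finset.mem_union, mem_missing, htab]
    rcases O.memo_answer L F w with ⟨h₁, h₂, b, -, h⟩ | ⟨h₁, h₂⟩
    · simp [h, h₁, h₂, hF h₁]
    · rw [h₂]
      grind
  · rw [Finset.disjoint_left]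
    intro w h h'
    simp only [known, Finset.mem_filter] at h
    exact h.2 (mem_missing.1 h').2

/-- The invariant of the data of the learner. -/
structure Sound (O : Obs t) (L : Language A) : Prop where
  memo_iff : ∀ w b, O.memo w = some b → (b = true ↔ w ∈ L)
  memo_mem : ∀ w, O.memo w ≠ none → w ∈ O.table
  wellMatched : ∀ i, ∀ q ∈ O.Q i, WellMatched q
  leftShape : ∀ i, ∀ c ∈ O.C i, LeftShape i c.1
  separated : ∀ i, ∀ q ∈ O.Q i, ∀ q' ∈ O.Q i, TestEquiv L (O.C i) q q' → q = q'
  card_tests : ∀ i, (O.C i).card ≤ Fintype.card A + (O.Q i).card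

theorem sound_initial [Nonempty A] (L : Language A) : (initial t).Sound L where
  memo_iff := by simp [initial]
  memo_mem := by simp [initial]
  wellMatched i q hq := by
    simp only [initial, Finset.mem_singleton] at hq
    exact hq ▸ .nil
  leftShape i c hc := by
    rcases i with _ | a
    · simp only [initial, Finset.mem_singleton] at hc
      subst hc
      rfl
    · simp only [initial, Finset.mem_image, Finset.mem_univ, true_and] at hc
      obtain ⟨b, rfl⟩ := hc
      exact ⟨[], rfl⟩
  separated i q hq q' hq' _ := by
    simp only [initial, Finset.mem_singleton] at hq hq'
    rw [hq, hq']
  card_tests i := by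
    rcases i with _ | a
    · simp [initial]
    · classical
      refine Finset.card_image_le.trans (le_add_right ?_)
      rw [Finset.card_univ]
      exact Fintype.card_subtype_le _

theorem sound_answer {O : Obs t} {L : Language A} (h : O.Sound L) {F : Finset (List A)}
    (hF : F ⊆ O.table) : (O.answer L F).Sound L where
  memo_iff w b hb := by
    rcases O.memo_answer L F w with ⟨h₁, h₂, b', h₃, h₄⟩ | ⟨h₁, h₂⟩
    · rw [hb, Option.some.injEq] at h₄
      exact h₄ ▸ h₃
    · exact h.memo_iff w b (h₂ ▸ hb)
  memo_mem w hw := by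
    rcases O.memo_answer L F w with ⟨h₁, -⟩ | ⟨-, h₂⟩
    · exact hF h₁
    · exact h.memo_mem w (h₂ ▸ hw)
  wellMatched := h.wellMatched
  leftShape := h.leftShape
  separated := h.separated
  card_tests := h.card_tests

/-! ### Adding words and tests; the work list -/

namespace Sound

variable {O : Obs t} {L : Language A}

theorem wellMatched_append (h : O.Sound L) {i : Option (Call t)} {q m : List (Hat t)}
    (hq : q ∈ O.Q i) (hm : m ∈ O.sigmaM) : WellMatched (q ++ m) := by
  rcases mem_sigmaM.1 hm with ⟨c, rfl⟩ | ⟨a, p, b, hp, rfl⟩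
  · exact .plain c (h.wellMatched i q hq)
  · exact .nest a b (h.wellMatched i q hq) (h.wellMatched _ p hp)

/-- Additional tests only refine the equivalence, so old words stay separated and only the new word
needs an argument. The hypothesis `hcard` says that tests grow no faster than words. -/
theorem extend (h : O.Sound L) {O' : Obs t} {i : Option (Call t)} {q : List (Hat t)}
    (hq : WellMatched q) (hm : O'.memo = O.memo)
    (hQ : ∀ j p, p ∈ O'.Q j ↔ p ∈ O.Q j ∨ j = i ∧ p = q)
    (hC : ∀ j, O.C j ⊆ O'.C j) (hC' : ∀ j, ∀ c ∈ O'.C j, c ∈ O.C j ∨ LeftShape j c.1)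
    (hcard : ∀ j, (O'.C j).card + (O.Q j).card ≤ (O.C j).card + (O'.Q j).card)
    (hsep : ∀ p ∈ O.Q i, ¬ TestEquiv L (O'.C i) q p) : O'.Sound L where
  memo_iff := hm ▸ h.memo_iff
  memo_mem w hw := table_mono (fun j p hp => (hQ j p).2 (.inl hp)) hC (h.memo_mem w (hm ▸ hw))
  wellMatched j p hp := by
    rcases (hQ j p).1 hp with hp | ⟨-, rfl⟩
    · exact h.wellMatched j p hp
    · exact hq
  leftShape j c hc := (hC' j c hc).elim (h.leftShape j c) id
  separated j p hp p' hp' he := by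
    rcases (hQ j p).1 hp with hp | ⟨rfl, rfl⟩ <;> rcases (hQ j p').1 hp' with hp' | ⟨hj, rfl⟩
    · exact h.separated j p hp p' hp' (he.mono (hC j))
    · subst hj
      exact (hsep p hp he.symm).elim
    · exact (hsep p' hp' he).elim
    · rfl
  card_tests j := by
    have := h.card_tests j
    have := hcard j
    omega

theorem addState (h : O.Sound L) {i : Option (Call t)} {q : List (Hat t)} (hq : WellMatched q)
    (hsep : ∀ p ∈ O.Q i, ¬ TestEquiv L (O.C i) q p) : (O.addState i q).Sound L :=
  h.extend hq rfl (fun _ _ => mem_Q_addState) (fun _ => subset_rfl) (fun _ _ hc => .inl hc)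
    (fun _ => Nat.add_le_add_left
      (Finset.card_le_card fun _ hp => mem_Q_addState.2 (.inl hp)) _) hsep

end Sound

theorem numWords_addState {O : Obs t} {i : Option (Call t)} {q : List (Hat t)} (hq : q ∉ O.Q i) :
    (O.addState i q).numWords = O.numWords + 1 := by
  classical
  have : ∀ j, ((O.addState i q).Q j).card = (O.Q j).card + if j = i then 1 else 0 := by
    intro j
    by_cases h : j = i
    · subst h
      simp [Obs.addState, hq]
    · simp [Obs.addState, h]
  simp only [numWords, this, Finset.sum_add_distrib]
  simp

/-- The old tests separate `q` from the words not equivalent to it, and the new test `c` from the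
others. One test comes with one word, which keeps the bound on the number of tests. -/
theorem Sound.addState_addTest {O : Obs t} {L : Language A} (h : O.Sound L)
    {i : Option (Call t)} {q : List (Hat t)} {c : List (Hat t) × List (Hat t)}
    (hq : WellMatched q) (hq' : q ∉ O.Q i) (hc : LeftShape i c.1)
    (hsep : ∀ p ∈ O.Q i, TestEquiv L (O.C i) q p → ¬ (plug c q ∈ L ↔ plug c p ∈ L)) :
    ((O.addState i q).addTest i c).Sound L := by
  classical
  have hC : ∀ j, ((O.addState i q).addTest i c).C j = if j = i then insert c (O.C j) else O.C j := by
    intro j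
    by_cases hj : j = i
    · subst hj
      simp [addTest, Obs.addState]
    · simp [addTest, hj, Obs.addState]
  refine h.extend (O' := (O.addState i q).addTest i c) (i := i) hq rfl
    (fun _ _ => mem_Q_addState) ?_ ?_ ?_ ?_
  · intro j c' hc'
    rw [hC]
    split <;> simp [hc']
  · intro j c' hc'
    rw [hC] at hc'
    split at hc'
    · rename_i hj
      subst hj
      rcases Finset.mem_insert.1 hc' with rfl | hc'
      · exact .inr hc
      · exact .inl hc'
    · exact .inl hc'
  · intro j
    have hQ : ((O.addState i q).addTest i c).Q j = (O.addState i q).Q j := rfl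
    rw [hC, hQ]
    by_cases hj : j = i
    · subst hj
      have := Finset.card_insert_le c (O.C j)
      simp only [if_true, Obs.addState, Function.update_self, Finset.card_insert_of_notMem hq']
      omega
    · simp [hj, Obs.addState]
  · intro p hp he
    rw [hC, if_pos rfl] at he
    exact hsep p hp (he.mono (Finset.subset_insert _ _)) (he c (Finset.mem_insert_self _ _))

theorem known_card_update (O : Obs t) (s : List (Hat t)) (n : ℕ) :
    O.known.card ≤ (O.update s n).known.card := by
  classical
  have key : ∀ i q c, O.known.card ≤ ((O.addState i q).addTest i c).known.card := by
    intro i q c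
    refine known_card_mono (O' := (O.addState i q).addTest i c)
      (fun j p hp => mem_Q_addState.2 (.inl hp)) (fun j => ?_) rfl
    by_cases hj : j = i
    · subst hj
      simp [addTest, Obs.addState]
    · simp [addTest, hj, Obs.addState]
  unfold update
  split
  · exact key _ _ _
  · exact key _ _ _
  · exact le_rfl

/-- All items that are not on the work list have been dealt with. -/
def Covered (O : Obs t) (L : Language A)
    (W : Finset (Option (Call t) × List (Hat t) × List (Hat t))) : Prop :=
  ∀ i, ∀ q ∈ O.Q i, ∀ m ∈ O.sigmaM,
    (i, q, m) ∈ W ∨ ∃ q' ∈ O.Q i, TestEquiv L (O.C i) (q ++ m) q'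

/-- The work list consists of items. -/
def Pending (O : Obs t) (W : Finset (Option (Call t) × List (Hat t) × List (Hat t))) : Prop :=
  ∀ i q m, (i, q, m) ∈ W → q ∈ O.Q i ∧ m ∈ O.sigmaM

theorem mem_sigmaM_addState {O : Obs t} {i : Option (Call t)} {q m : List (Hat t)} :
    m ∈ (O.addState i q).sigmaM ↔ m ∈ O.sigmaM ∨ ∃ a, i = some a ∧ m ∈ nested a q := by
  simp only [mem_sigmaM, mem_Q_addState, nested, Finset.mem_image, Finset.mem_univ, true_and]
  constructor
  · rintro (h | ⟨a, p, b, hp | ⟨rfl, rfl⟩, rfl⟩)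
    · exact .inl (.inl h)
    · exact .inl (.inr ⟨a, p, b, hp, rfl⟩)
    · exact .inr ⟨a, rfl, b, rfl⟩
  · rintro ((h | ⟨a, p, b, hp, rfl⟩) | ⟨a, rfl, b, rfl⟩)
    · exact .inl h
    · exact .inr ⟨a, p, b, .inl hp, rfl⟩
    · exact .inr ⟨a, q, b, .inr ⟨rfl, rfl⟩, rfl⟩

theorem mem_newItems {O : Obs t} {i j : Option (Call t)} {q p m : List (Hat t)} :
    (j, p, m) ∈ O.newItems i q ↔ (j = i ∧ p = q ∧ m ∈ O.sigmaM) ∨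
      (p ∈ (O.addState i q).Q j ∧ ∃ a, i = some a ∧ m ∈ nested a q) := by
  rcases i with _ | a
  · simp only [newItems, Finset.mem_union, Finset.mem_image, Prod.mk.injEq]
    grind
  · simp only [newItems, Finset.mem_union, Finset.mem_image, Prod.mk.injEq, mem_items]
    grind

/-- The item just handled is covered by its own word. The rest that is new is the new word followed
by old symbols, or any word followed by a nested word around the new one; both are put on the work
list. -/
theorem Covered.addState {O : Obs t} {L : Language A}
    {W : Finset (Option (Call t) × List (Hat t) × List (Hat t))} {i : Option (Call t)}
    {q m : List (Hat t)} [DecidableEq (Option (Call t) × List (Hat t) × List (Hat t))]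
    (h : O.Covered L (insert (i, q, m) W)) :
    (O.addState i (q ++ m)).Covered L (W ∪ O.newItems i (q ++ m)) := by
  intro j p hp n hn
  rw [Finset.mem_union, mem_newItems]
  rcases mem_sigmaM_addState.1 hn with hn' | hn'
  · rcases mem_Q_addState.1 hp with hp | ⟨rfl, rfl⟩
    · rcases h j p hp n hn' with h | ⟨q', hq', h⟩
      · rcases Finset.mem_insert.1 h with h | h
        · cases h
          exact .inr ⟨_, mem_Q_addState.2 (.inr ⟨rfl, rfl⟩), .refl _⟩
        · exact .inl (.inl h)
      · exact .inr ⟨q', mem_Q_addState.2 (.inl hq'), h⟩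
    · exact .inl (.inr (.inl ⟨rfl, rfl, hn'⟩))
  · exact .inl (.inr (.inr ⟨hp, hn'⟩))

theorem Pending.addState {O : Obs t}
    {W : Finset (Option (Call t) × List (Hat t) × List (Hat t))} {i : Option (Call t)}
    {q : List (Hat t)} [DecidableEq (Option (Call t) × List (Hat t) × List (Hat t))]
    (h : O.Pending W) : (O.addState i q).Pending (W ∪ O.newItems i q) := by
  intro j p n hn
  rw [Finset.mem_union, mem_newItems] at hn
  rw [mem_sigmaM_addState]
  rcases hn with hn | ⟨rfl, rfl, hn⟩ | ⟨hp, hn⟩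
  · exact ⟨mem_Q_addState.2 (.inl (h j p n hn).1), .inl (h j p n hn).2⟩
  · exact ⟨mem_Q_addState.2 (.inr ⟨rfl, rfl⟩), .inl hn⟩
  · exact ⟨hp, .inr hn⟩

/-- The table is closed and filled, so that it determines a hypothesis. -/
structure Ready (O : Obs t) (L : Language A) : Prop extends O.Sound L where
  closed : ∀ i, ∀ q ∈ O.Q i, ∀ m ∈ O.sigmaM, ∃ q' ∈ O.Q i, TestEquiv L (O.C i) (q ++ m) q'
  filled : ∀ w ∈ O.table, O.memo w ≠ none

/-! ### Closed tables and the analysis of counterexamples -/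

namespace Ready

variable {O : Obs t} {L : Language A}

theorem target_equiv (h : O.Ready L) {i : Option (Call t)} {q m : List (Hat t)}
    (hq : q ∈ O.Q i) (hm : m ∈ O.sigmaM) :
    TestEquiv L (O.C i) (O.target i (q ++ m)).1 (q ++ m) := by
  have key : ∀ q' ∈ O.Q i, (O.Equiv i q' (q ++ m) ↔ TestEquiv L (O.C i) q' (q ++ m)) :=
    fun q' hq' => equiv_iff h.memo_iff
      (fun c hc => h.filled _ (mem_table.2 (.inr ⟨i, c, hc, q', hq', .inl rfl⟩)))
      (fun c hc => h.filled _ (mem_table.2 (.inr ⟨i, c, hc, q, hq, .inr ⟨m, hm, rfl⟩⟩)))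
  have hex : ∃ q' ∈ O.Q i, O.Equiv i q' (q ++ m) := by
    obtain ⟨q', hq', he⟩ := h.closed i q hq m hm
    exact ⟨q', hq', (key q' hq').2 he.symm⟩
  rw [target, dif_pos hex]
  exact (key _ hex.choose_spec.1).1 hex.choose_spec.2

theorem mem_final_iff (h : O.Ready L) (q : {q // q ∈ O.Q none}) :
    q ∈ O.construct.final ↔ q.1.map untag ∈ L := by
  obtain ⟨b, hb⟩ := Option.ne_none_iff_exists'.1
    (h.filled _ (mem_table.2 (.inl ⟨q.1, q.2, rfl⟩)))
  rw [← h.memo_iff _ _ hb]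
  change O.memo (q.1.map untag) = some true ↔ _
  rw [hb, Option.some.injEq]

/-- By separation, the target is the only access word of the module equivalent to `q ++ m`. A test
that distinguishes these two therefore makes `q ++ m` inequivalent to every access word. -/
theorem refine_module (h : O.Ready L) {i : Option (Call t)} {q m l r : List (Hat t)}
    (hq : q ∈ O.Q i) (hm : m ∈ O.sigmaM) (hl : LeftShape i l)
    (hne : ¬ (plug (l, r) (q ++ m) ∈ L ↔ plug (l, r) (O.target i (q ++ m)).1 ∈ L)) :
    ((O.addState i (q ++ m)).addTest i (l, r)).Sound L ∧
      ((O.addState i (q ++ m)).addTest i (l, r)).numWords = O.numWords + 1 := by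
  have hsep : ∀ p ∈ O.Q i, TestEquiv L (O.C i) (q ++ m) p →
      ¬ (plug (l, r) (q ++ m) ∈ L ↔ plug (l, r) p ∈ L) := by
    intro p hp he
    rwa [← h.separated i _ (O.target i (q ++ m)).2 p hp ((h.target_equiv hq hm).trans he)]
  have hmem : q ++ m ∉ O.Q i := fun hp => hsep _ hp (.refl _) Iff.rfl
  exact ⟨h.toSound.addState_addTest (h.wellMatched_append hq hm) hmem hl hsep,
    numWords_addState hmem⟩

/-- Across a plain or return symbol, both context strings apply the context of the second prefix:
the first to an access word extended by an element of `sigmaM`, the second to its target. So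
`refine_module` applies. -/
theorem sound_update (h : O.Ready L) {s : List (Hat t)} {n : ℕ} (hn : n < s.length)
    (hrun : ∃ x, O.construct.run s = some x)
    (hne : ¬ (O.contextString s n ∈ L ↔ O.contextString s (n + 1) ∈ L)) :
    (O.update s n).Sound L ∧ (O.update s n).numWords = O.numWords + 1 := by
  have hsplit : s.take (n + 1) ++ s.drop (n + 1) = s := List.take_append_drop _ _
  obtain ⟨y, hy⟩ : ∃ y, O.construct.run (s.take (n + 1)) = some y := by
    obtain ⟨x, hx⟩ := hrun
    rw [← hsplit, KSEVPA.run, List.foldlM_append] at hx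
    obtain ⟨y, hy, -⟩ := Option.bind_eq_some_iff.1 hx
    exact ⟨y, hy⟩
  have hstep := hy
  rw [List.take_succ_eq_append_getElem hn, KSEVPA.run, List.foldlM_append] at hstep
  obtain ⟨x, hx, hstep⟩ := Option.bind_eq_some_iff.1 hstep
  change O.construct.run (s.take n) = some x at hx
  have hdrop : s.drop n = s[n] :: s.drop (n + 1) := List.drop_eq_getElem_cons hn
  obtain ⟨r, hr⟩ : ∃ r, s.drop (n + 1) = r := ⟨_, rfl⟩
  rw [hr] at hdrop
  generalize s[n] = z at hstep hdrop
  obtain ⟨⟨i, q⟩, st⟩ := x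
  have hvalid := O.construct.run_validStack hx
  replace hstep : O.construct.step (⟨i, q⟩, st) z = some y := by simpa using hstep
  have hctx : O.contextString s n = plug (O.leftContext i st, z :: r) q.1 := by
    simp only [contextString, hx, hdrop]
  have hctx' : O.contextString s (n + 1) =
      plug (O.leftContext y.1.1 y.2, r) (show {q // q ∈ O.Q y.1.1} from y.1.2).1 := by
    simp only [contextString, hy, hr]
  rw [hctx, hctx'] at hne
  cases z with
  | call a =>
    simp only [KSEVPA.step, Option.some.injEq] at hstep
    subst hstep
    -- A call moves the access word and the call symbol into the left context, and the entry word is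
    -- empty, so the string does not change.
    refine (hne ?_).elim
    simp [leftContext, plug, construct]
  | plain c =>
    simp only [KSEVPA.step, Option.some.injEq] at hstep
    subst hstep
    have hup : O.update s n =
        (O.addState i (q.1 ++ [.plain c])).addTest i (O.leftContext i st, r) := by
      simp only [update, hx, hdrop]
    rw [hup]
    refine h.refine_module q.2 (mem_sigmaM.2 (.inl ⟨c, rfl⟩)) (O.leftShape_leftContext hvalid) ?_
    rwa [← plug_append_right]
  | ret b =>
    rcases i with _ | a
    · simp [KSEVPA.step] at hstep
    · rcases st with _ | ⟨⟨j, q'⟩, st⟩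
      · simp [KSEVPA.step] at hstep
      · simp only [KSEVPA.step, Option.some.injEq] at hstep
        subst hstep
        have hup : O.update s n = (O.addState j (q'.1 ++ ([.call a] ++ q.1 ++ [.ret b]))).addTest j
            (O.leftContext j st, r) := by
          simp only [update, hx, hdrop, List.append_assoc]
        have htarget : O.construct.onRet a q b j q' =
            O.target j (q'.1 ++ ([.call a] ++ q.1 ++ [.ret b])) := by
          simp only [construct, List.append_assoc]
        rw [hup]
        refine h.refine_module q'.2 (mem_sigmaM.2 (.inr ⟨a, q.1, b, q.2, rfl⟩))
          (O.leftShape_leftContext (i := j) hvalid) ?_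
        rw [← htarget]
        convert hne using 3
        simp [plug, leftContext]

end Ready

end Obs

/-! ### Ends of a counterexample, and bounds on the table -/

namespace Obs

section Hypothesis

variable {A : Type u} {t : A → Kind}

theorem recognizes_of_forall_mem_iff {O : Obs t} {L : Language A}
    (heq : ∀ w, w ∈ L ↔ w ∈ untaggedLanguage t O.construct) :
    O.construct.Recognizes (taggedLanguage t L) := fun w => by
  rw [mem_taggedLanguage_iff, heq]
  change _ ↔ O.construct.Accepts _
  rw [map_tag_map_untag]

/-- An accepted word has such a run by definition, and a rejected counterexample is in the language,
where no automaton gets stuck. Hence no context string along it is the default value. -/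
theorem exists_run_of_counterexample {O : Obs t} {L : Language A}
    {g : ContextFreeGrammar.{u} (Hat t)} (hg : IsVPG g) (hgL : g.language = taggedLanguage t L)
    {s : List A} (hs : ¬ (s ∈ L ↔ s ∈ untaggedLanguage t O.construct)) :
    ∃ q, O.construct.run (s.map (tag t)) = some (⟨none, q⟩, []) := by
  by_cases h : s ∈ untaggedLanguage t O.construct
  · obtain ⟨q, -, hq⟩ := h
    exact ⟨q, hq⟩
  · refine exists_run_of_mem_language hg ?_ _
    rw [hgL]
    exact ⟨s, by tauto, rfl⟩

theorem contextString_zero (O : Obs t) (s : List (Hat t)) :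
    O.contextString s 0 = s.map untag := by
  simp [contextString, KSEVPA.run, leftContext, plug, construct]

end Hypothesis

variable {A : Type u} {t : A → Kind} [Fintype A]

theorem numWords_pos (O : Obs t) : 0 < O.numWords := by
  classical
  exact (Finset.card_pos.2 ⟨_, O.nil_mem none⟩).trans_le
    (Finset.single_le_sum (f := fun i => (O.Q i).card) (fun _ _ => Nat.zero_le _)
      (Finset.mem_univ none))

theorem card_Q_le_numWords (O : Obs t) (i : Option (Call t)) : (O.Q i).card ≤ O.numWords := by
  classical
  exact Finset.single_le_sum (f := fun i => (O.Q i).card) (fun _ _ => Nat.zero_le _)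
    (Finset.mem_univ i)

theorem card_sigmaM_le (O : Obs t) :
    O.sigmaM.card ≤ Fintype.card A + O.numWords * Fintype.card A := by
  classical
  have hnested : ∀ (a : Call t) (q : List (Hat t)), (nested a q).card ≤ Fintype.card A :=
    fun a q => Finset.card_image_le.trans (by
      rw [Finset.card_univ]
      exact Fintype.card_subtype_le _)
  refine (Finset.card_union_le _ _).trans (Nat.add_le_add ?_ ?_)
  · refine Finset.card_image_le.trans ?_
    rw [Finset.card_univ]
    exact Fintype.card_subtype_le _
  · calc _ ≤ ∑ a : Call t, (O.Q (some a)).card * Fintype.card A :=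
          Finset.card_biUnion_le.trans (Finset.sum_le_sum fun a _ =>
            Finset.card_biUnion_le_card_mul _ _ _ fun q _ => hnested a q)
      _ = (∑ a : Call t, (O.Q (some a)).card) * Fintype.card A := by rw [Finset.sum_mul]
      _ ≤ _ := by
        refine Nat.mul_le_mul_right _ ?_
        rw [numWords, Fintype.sum_option]
        exact Nat.le_add_left _ _

/-- With `z` words in all and `x` characters, a module has at most `2zx` tests, and each of its
words has at most `3zx` rows, itself included. Summing `|Q i|` over the modules gives a single
factor `z`, so the number of modules does not enter. The constant is `2 * 3` plus one for the words
of the base module. -/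
theorem Sound.card_table_le [Nonempty A] {O : Obs t} {L : Language A} (h : O.Sound L) :
    O.table.card ≤ 7 * (O.numWords ^ 3 * Fintype.card A ^ 2) := by
  classical
  have hs := O.card_sigmaM_le
  have hA : 1 ≤ Fintype.card A := Fintype.card_pos
  have hm : 1 ≤ O.numWords := O.numWords_pos
  have hQ := O.card_Q_le_numWords
  have hC := h.card_tests
  have htab : O.table.card ≤ (O.Q none).card +
      ∑ i : Option (Call t), (O.C i).card * ((O.Q i).card * (O.sigmaM.card + 1)) := by
    refine (Finset.card_union_le _ _).trans (Nat.add_le_add Finset.card_image_le ?_)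
    refine Finset.card_biUnion_le.trans (Finset.sum_le_sum fun i _ => ?_)
    refine Finset.card_biUnion_le_card_mul _ _ _ fun c _ => ?_
    refine Finset.card_biUnion_le_card_mul _ _ _ fun q _ => ?_
    exact (Finset.card_insert_le _ _).trans (Nat.succ_le_succ Finset.card_image_le)
  generalize hx : Fintype.card A = x at *
  generalize O.sigmaM.card = y at *
  generalize hz : O.numWords = z at *
  have h₁ : x ≤ z * x := Nat.le_mul_of_pos_left _ hm
  have h₂ : z ≤ z * x := Nat.le_mul_of_pos_right _ hA
  have hy : y + 1 ≤ 3 * (z * x) := by omega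
  have hsum : ∑ i : Option (Call t), (O.C i).card * ((O.Q i).card * (y + 1)) ≤
      ∑ i : Option (Call t), (O.Q i).card * (2 * (z * x) * (3 * (z * x))) := by
    refine Finset.sum_le_sum fun i _ => ?_
    calc _ = (O.Q i).card * ((O.C i).card * (y + 1)) := by ring
      _ ≤ _ := Nat.mul_le_mul_left _ (Nat.mul_le_mul
        (by have := hC i; have := hQ i; omega) hy)
  rw [← Finset.sum_mul] at hsum
  change _ ≤ O.numWords * _ at hsum
  rw [hz] at hsum
  calc O.table.card ≤ z + z * (2 * (z * x) * (3 * (z * x))) :=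
        htab.trans (Nat.add_le_add (hQ none) hsum)
    _ = z * 1 + 6 * (z ^ 3 * x ^ 2) := by ring
    _ ≤ z * (z ^ 2 * x ^ 2) + 6 * (z ^ 3 * x ^ 2) :=
      Nat.add_le_add_right (Nat.mul_le_mul_left _ (Nat.mul_pos (by positivity) (by positivity))) _
    _ = _ := by ring

open Classical in
-- Words of equal signature pass the same tests, so the signature is injective on each module. This
-- crude bound serves termination only.
theorem Sound.numWords_le {O : Obs t} {L : Language A} (h : O.Sound L) {κ : Type} [Finite κ]
    {sig : List (Hat t) → κ} (hsig : ∀ u v, WellMatched u → WellMatched v → sig u = sig v →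
      ∀ l r, l ++ u ++ r ∈ taggedLanguage t L → l ++ v ++ r ∈ taggedLanguage t L) :
    O.numWords ≤ Fintype.card (Option (Call t)) * Nat.card κ := by
  have : ∀ i ∈ (Finset.univ : Finset (Option (Call t))), (O.Q i).card ≤ Nat.card κ := by
    intro i _
    have hinj : Function.Injective fun q : {q // q ∈ O.Q i} => sig q.1 := by
      rintro ⟨q, hq⟩ ⟨q', hq'⟩ he
      have hw := h.wellMatched i q hq
      have hw' := h.wellMatched i q' hq'
      refine Subtype.ext (h.separated i q hq q' hq' fun c _ => ?_)
      rw [plug_mem_iff, plug_mem_iff]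
      exact ⟨hsig q q' hw hw' he _ _, hsig q' q hw' hw he.symm _ _⟩
    simpa using Nat.card_le_card_of_injective _ hinj
  refine (Finset.sum_le_card_nsmul _ _ _ this).trans_eq ?_
  rw [Finset.card_univ, smul_eq_mul]

/-! ### Minimality and uniqueness -/

section Minimal

variable {O : Obs t} {L : Language A} {N : KSEVPA (Call t) (Ret t) (Plain t)}

theorem Sound.reach_injective (h : O.Sound L) (hN : N.Recognizes (taggedLanguage t L))
    (i : Option (Call t)) : Function.Injective fun q : {q // q ∈ O.Q i} => N.reach i q.1 :=
  fun q q' he => Subtype.ext (h.separated i q.1 q.2 q'.1 q'.2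
    (.of_reach hN (h.leftShape i) (h.wellMatched i _ q.2) (h.wellMatched i _ q'.2) he))

theorem Sound.sigma_reach_injective (h : O.Sound L) (hN : N.Recognizes (taggedLanguage t L)) :
    Function.Injective fun x : (i : Option (Call t)) × {q // q ∈ O.Q i} =>
      (⟨x.1, N.reach x.1 x.2.1⟩ : N.State) :=
  Function.Injective.sigma_map Function.injective_id fun i => h.reach_injective hN i

theorem Sound.size_le (h : O.Sound L) (hN : N.Recognizes (taggedLanguage t L)) :
    O.construct.size ≤ N.size := by
  have := N.finite_Q
  exact Nat.card_le_card_of_injective _ (h.sigma_reach_injective hN)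

theorem Sound.reach_surjective (h : O.Sound L) (hN : N.Recognizes (taggedLanguage t L))
    (hsize : N.size ≤ O.construct.size) (i : Option (Call t)) :
    Function.Surjective fun q : {q // q ∈ O.Q i} => N.reach i q.1 := by
  have := N.finite_Q
  intro p
  obtain ⟨⟨j, q⟩, he⟩ :=
    ((h.sigma_reach_injective hN).bijective_of_nat_card_le hsize).2 ⟨i, p⟩
  simp only [Sigma.mk.injEq] at he
  obtain ⟨rfl, he⟩ := he
  exact ⟨q, eq_of_heq he⟩

/-- By surjectivity some access word reaches the same state of `N` as `q ++ m`. It passes the same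
tests as `q ++ m`, hence as the target, and by separation it is the target. -/
theorem Ready.reach_target (h : O.Ready L) (hN : N.Recognizes (taggedLanguage t L))
    (hsize : N.size ≤ O.construct.size) {i : Option (Call t)} {q m : List (Hat t)}
    (hq : q ∈ O.Q i) (hm : m ∈ O.sigmaM) :
    N.reach i (O.target i (q ++ m)).1 = N.reach i (q ++ m) := by
  obtain ⟨p, hp⟩ := h.reach_surjective hN hsize i (N.reach i (q ++ m))
  have he : TestEquiv L (O.C i) p.1 (q ++ m) :=
    .of_reach hN (h.leftShape i) (h.wellMatched i _ p.2) (h.wellMatched_append hq hm) hp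
  rw [← h.separated i _ p.2 _ (O.target i (q ++ m)).2 (he.trans (h.target_equiv hq hm).symm)]
  exact hp

/-- A hypothesis is isomorphic to every automaton for the language that is not larger. -/
noncomputable def Ready.iso (h : O.Ready L) (hN : N.Recognizes (taggedLanguage t L))
    (hsize : N.size ≤ O.construct.size) : O.construct.Iso N where
  toEquiv i := Equiv.ofBijective (fun q : {q // q ∈ O.Q i} => N.reach i q.1)
    ⟨h.reach_injective hN i, h.reach_surjective hN hsize i⟩
  map_entry i := N.reach_nil i
  map_onPlain i q c :=
    (h.reach_target hN hsize q.2 (mem_sigmaM.2 (.inl ⟨c, rfl⟩))).trans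
      (N.reach_plain (h.wellMatched i _ q.2) i c)
  map_onRet a q b j q' := by
    have hw := N.reach_nest (h.wellMatched j _ q'.2) (h.wellMatched _ _ q.2) j a b
    rw [← h.reach_target hN hsize q'.2 (mem_sigmaM.2 (.inr ⟨a, q.1, b, q.2, rfl⟩))] at hw
    simp only [← List.append_assoc] at hw
    exact hw
  map_final q := by
    refine Iff.trans ?_ (h.mem_final_iff q).symm
    refine (N.accepts_iff_reach (h.wellMatched none _ q.2)).symm.trans ?_
    rw [hN, mem_taggedLanguage_iff]

end Minimal

end Obs

/-! ### Invariant, rank and query counts along a run -/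

section Run

variable {A : Type u} {t : A → Kind} [Fintype A]

open Obs

/-- The invariant of the learner, for a state and the numbers of membership queries and
equivalence queries and the maximal length of a counterexample so far. -/
def LearnerInvariant (L : Language A) (a e n : ℕ) : VState t → Prop
  | .closing O W => O.Sound L ∧ O.Covered L W ∧ O.Pending W ∧ e + 1 ≤ O.numWords ∧
      a ≤ O.known.card + e * Nat.clog 2 n
  | .checking O W i q m => O.Sound L ∧
      (open Classical in O.Covered L (insert (i, q, m) W)) ∧ O.Pending W ∧
      q ∈ O.Q i ∧ m ∈ O.sigmaM ∧ e + 1 ≤ O.numWords ∧ a ≤ O.known.card + e * Nat.clog 2 n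
  | .asking O => O.Ready L ∧ e + 1 ≤ O.numWords ∧ a ≤ O.known.card + e * Nat.clog 2 n
  | .searching O s lo hi => O.Ready L ∧ (∃ q, O.construct.run s = some (⟨none, q⟩, [])) ∧
      lo < hi ∧ hi ≤ s.length ∧ (O.contextString s lo ∈ L ↔ ¬ O.construct.Accepts s) ∧
      (O.contextString s hi ∈ L ↔ O.construct.Accepts s) ∧ e ≤ O.numWords ∧
      a + Nat.clog 2 (hi - lo) ≤ O.known.card + e * Nat.clog 2 n
  | .done O => O.Ready L ∧ O.construct.Recognizes (taggedLanguage t L) ∧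
      e ≤ O.numWords ∧ a ≤ O.known.card + e * Nat.clog 2 n

theorem toLex_lt_toLex_iff {x y z x' y' z' : ℕ} :
    (toLex (x, toLex (y, z)) : ℕ ×ₗ ℕ ×ₗ ℕ) < toLex (x', toLex (y', z')) ↔
      x < x' ∨ x = x' ∧ (y < y' ∨ y = y' ∧ z < z') := by
  rw [Prod.Lex.toLex_lt_toLex, Prod.Lex.toLex_lt_toLex]

/-- A rank that decreases in every step of the learner, if there are at most `B` access words. -/
noncomputable def learnerRank (B : ℕ) : VState t → ℕ ×ₗ ℕ ×ₗ ℕ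
  | .closing O W => toLex (B - O.numWords, toLex (3, 2 * W.card))
  | .checking O W _ _ _ => toLex (B - O.numWords, toLex (3, 2 * W.card + 1))
  | .asking O => toLex (B - O.numWords, toLex (2, 0))
  | .searching O _ lo hi => toLex (B - O.numWords, toLex (1, hi - lo))
  | .done O => toLex (B - O.numWords, toLex (0, 0))

theorem covered_items (O : Obs t) (L : Language A) : O.Covered L (O.items O.sigmaM) :=
  fun _ _ hq _ hm => .inl (mem_items.2 ⟨hq, hm⟩)

theorem pending_items (O : Obs t) : O.Pending (O.items O.sigmaM) :=
  fun _ _ _ h => mem_items.1 h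

theorem learnerInvariant_init [Nonempty A] (L : Language A) :
    LearnerInvariant L 0 0 0 (startClosing (Obs.initial t)) :=
  ⟨sound_initial L, covered_items _ L, pending_items _, numWords_pos _, Nat.zero_le _⟩

theorem clog_two_half {d k : ℕ} (hd : 1 < d) (hk : k ≤ (d + 1) / 2) :
    Nat.clog 2 k + 1 ≤ Nat.clog 2 d := by
  rw [Nat.clog_of_two_le one_lt_two hd]
  exact Nat.succ_le_succ (Nat.clog_mono_right 2 (by omega))

theorem clog_two_le_log (n : ℕ) : (Nat.clog 2 n : ℝ) ≤ 3 * Real.log n := by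
  rcases Nat.lt_or_ge n 2 with h | h
  -- For `n = 0`, which covers runs without a counterexample, this uses `Real.log 0 = 0`.
  · interval_cases n <;> simp
  · have hpow : 2 ^ (Nat.clog 2 n - 1) ≤ n :=
      (Nat.pow_pred_clog_lt_self one_lt_two h).le
    have hpos : 1 ≤ Nat.clog 2 n := Nat.clog_pos one_lt_two h
    have h₁ : ((Nat.clog 2 n - 1 : ℕ) : ℝ) * Real.log 2 ≤ Real.log n := by
      rw [← Real.log_pow]
      exact Real.log_le_log (by positivity) (by exact_mod_cast hpow)
    have h₂ : Real.log 2 ≤ Real.log n := Real.log_le_log two_pos (by exact_mod_cast h)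
    have h₃ := Real.log_two_gt_d9
    rw [Nat.cast_sub hpos, Nat.cast_one] at h₁
    have h₄ : (1 : ℝ) ≤ Nat.clog 2 n := by exact_mod_cast hpos
    -- Adding `h₁` and `h₂` gives `clog * log 2 ≤ 2 * log n`, and `2 / log 2 < 3`.
    nlinarith

theorem Obs.Ready.contextString_length {O : Obs t} {L : Language A} (h : O.Ready L)
    {s : List (Hat t)} {q : O.construct.Q none} (hq : O.construct.run s = some (⟨none, q⟩, [])) :
    O.contextString s s.length ∈ L ↔ O.construct.Accepts s := by
  have h₁ : O.contextString s s.length = (show {q // q ∈ O.Q none} from q).1.map untag := by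
    simp only [contextString, List.take_length, hq, List.drop_length, plug, leftContext,
      List.nil_append, List.append_nil]
  rw [h₁, ← h.mem_final_iff]
  constructor
  · exact fun h => ⟨q, h, hq⟩
  · rintro ⟨q', h', hq'⟩
    rw [hq] at hq'
    have : q = q' := by simpa using hq'
    exact this ▸ h'

/-- The new equivalence query raises the budget `e * Nat.clog 2 n` by enough for the whole binary
search, even if `n` grows. The slack in `e + 1 ≤ O.numWords` is used up here and restored by the
word that the search yields. -/
theorem learnerInvariant_counterexample {O : Obs t} {L : Language A} {a e n : ℕ}
    {g : ContextFreeGrammar.{u} (Hat t)} (hg : IsVPG g) (hgL : g.language = taggedLanguage t L)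
    (h : LearnerInvariant L a e n (.asking O)) {s : List A}
    (hs : ¬ (s ∈ L ↔ s ∈ untaggedLanguage t O.construct)) :
    LearnerInvariant L a (e + 1) (max n s.length)
      (.searching O (s.map (tag t)) 0 s.length) := by
  obtain ⟨hR, he, ha⟩ := h
  obtain ⟨q, hq⟩ := exists_run_of_counterexample hg hgL hs
  have hlen := hR.contextString_length hq
  have hzero := O.contextString_zero (s.map (tag t))
  rw [map_untag_map_tag] at hzero
  rw [List.length_map] at hlen
  have hs' : ¬ (s ∈ L ↔ O.construct.Accepts (s.map (tag t))) := hs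
  refine ⟨hR, ⟨q, hq⟩, ?_, by simp, ?_, hlen, he, ?_⟩
  · rcases Nat.eq_zero_or_pos s.length with h0 | h0
    · rw [h0, hzero] at hlen
      exact (hs' hlen).elim
    · exact h0
  · rw [hzero]
    tauto
  · have h₁ : Nat.clog 2 n ≤ Nat.clog 2 (max n s.length) := Nat.clog_mono_right 2 (le_max_left _ _)
    have h₂ : Nat.clog 2 s.length ≤ Nat.clog 2 (max n s.length) :=
      Nat.clog_mono_right 2 (le_max_right _ _)
    have h₃ := Nat.mul_le_mul_left e h₁
    rw [Nat.sub_zero, Nat.succ_mul]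
    omega

/-- A new word lowers the first component of the rank, where `B` keeps the truncated subtraction
strict. With the words unchanged, the learner shrinks its work list or search interval, or passes to
a later phase. -/
theorem learner_step {L : Language A} {g : ContextFreeGrammar.{u} (Hat t)} (hg : IsVPG g)
    (hgL : g.language = taggedLanguage t L) {B : ℕ} (hB : ∀ O : Obs t, O.Sound L → O.numWords ≤ B)
    {c c' : Snapshot (learner t).State} (hstep : (learner t).Step (untaggedLanguage t) L c c')
    (h : LearnerInvariant L c.numMemb c.numEquiv c.maxLen c.state) :
    LearnerInvariant L c'.numMemb c'.numEquiv c'.maxLen c'.state ∧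
      learnerRank B c'.state < learnerRank B c.state := by
  classical
  cases hstep with
  | @goto s N s' a e n ha hs' =>
    change VState t at s s'
    change act s = _ at ha
    change LearnerInvariant L a e n s at h
    change LearnerInvariant L a e n s' ∧ learnerRank B s' < learnerRank B s
    cases s with
    | closing O W =>
      simp only [act] at ha
      split_ifs at ha
      · simp [ask] at ha
      · cases ha
        obtain ⟨⟨i, q, m⟩, hx, rfl⟩ := hs'
        obtain ⟨hS, hC, hP, he, ha⟩ := h
        refine ⟨⟨hS, ?_, ?_, (hP i q m hx).1, (hP i q m hx).2, he, ha⟩, ?_⟩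
        · convert hC
          exact Finset.insert_erase hx
        · exact fun j p k hk => hP j p k (Finset.mem_of_mem_erase hk)
        -- Taking an item turns `2|W|` into `2(|W| - 1) + 1`, and dealing with it removes the `1`;
        -- hence the factor two in the rank.
        · have := Finset.card_pos.2 ⟨_, hx⟩
          simp only [learnerRank, toLex_lt_toLex_iff, true_and, Finset.card_erase_of_mem hx]
          omega
    | checking O W i q m => simp [act, ask] at ha
    | asking O => simp [act] at ha
    | searching O s lo hi =>
      simp only [act] at ha
      split_ifs at ha with hlt
      cases ha
      cases hs'
      obtain ⟨hR, ⟨q, hq⟩, h₁, h₂, h₃, h₄, he, ha⟩ := h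
      -- The interval has shrunk to one symbol, with opposite memberships at its two ends.
      obtain rfl : hi = lo + 1 := by omega
      obtain ⟨hS, hn⟩ := hR.sound_update (s := s) (n := lo) h₂ ⟨_, hq⟩ (by tauto)
      refine ⟨⟨hS, covered_items _ L, pending_items _, by omega, ?_⟩, ?_⟩
      · have := O.known_card_update s lo
        have h₅ : Nat.clog 2 (lo + 1 - lo) = 0 := by simp
        omega
      · have := hB _ hS
        simp only [learnerRank, startClosing, toLex_lt_toLex_iff]
        omega
    | done O => simp [act] at ha
  | @memb s F k a e n ha =>
    change VState t at s
    change act s = _ at ha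
    change LearnerInvariant L a e n s at h
    change LearnerInvariant L (a + F.card) e n (k fun w => decide (w.1 ∈ L)) ∧
      learnerRank B (k fun w => decide (w.1 ∈ L)) < learnerRank B s
    cases s with
    | closing O W =>
      simp only [act] at ha
      split_ifs at ha with hW
      subst hW
      obtain ⟨hS, hC, hP, he, ha'⟩ := h
      cases ha
      change LearnerInvariant L _ e n (.asking (O.answer L O.table)) ∧
        learnerRank B (.asking (O.answer L O.table)) < _
      have hcard := O.card_known_answer L (Finset.Subset.refl O.table)
      refine ⟨⟨⟨sound_answer hS subset_rfl, fun i q hq m hm => ?_, fun w hw => ?_⟩, he, ?_⟩, ?_⟩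
      · exact (hC i q hq m hm).resolve_left (Finset.notMem_empty _)
      · exact O.memo_answer_ne_none L hw
      · omega
      · have : (O.answer L O.table).numWords = O.numWords := rfl
        simp only [learnerRank, toLex_lt_toLex_iff, true_and, this]
        omega
    | checking O W i q m =>
      obtain ⟨hS, hC, hP, hq, hm, he, ha'⟩ := h
      simp only [act, ask] at ha
      cases ha
      set O' := O.answer L (O.tests i (q ++ m)) with hO'
      have hsub := tests_subset_table hq hm
      have hS' : O'.Sound L := sound_answer hS hsub
      have hcard : O'.known.card = O.known.card + (O.missing (O.tests i (q ++ m))).card :=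
        O.card_known_answer L hsub
      have hiff : ∀ q' ∈ O'.Q i, O'.Equiv i (q ++ m) q' ↔ TestEquiv L (O'.C i) (q ++ m) q' := by
        intro q' hq'
        refine equiv_iff hS'.memo_iff (fun c hc => ?_) (fun c hc => ?_)
        · refine O.memo_answer_ne_none L ?_
          simp only [tests, Finset.mem_biUnion, Finset.mem_image]
          exact ⟨c, hc, _, Finset.mem_insert_self _ _, rfl⟩
        · refine O.memo_answer_ne_none L ?_
          simp only [tests, Finset.mem_biUnion, Finset.mem_image]
          exact ⟨c, hc, _, Finset.mem_insert_of_mem hq', rfl⟩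
      change LearnerInvariant L _ e n (if ∃ q' ∈ O'.Q i, O'.Equiv i (q ++ m) q' then _ else _) ∧
        learnerRank B (if ∃ q' ∈ O'.Q i, O'.Equiv i (q ++ m) q' then _ else _) < _
      split_ifs with hex
      · refine ⟨⟨hS', fun j p hp k hk => ?_, hP, he, ?_⟩, ?_⟩
        · rcases hC j p hp k hk with h | h
          · rcases Finset.mem_insert.1 h with h | h
            · cases h
              obtain ⟨q', hq', h'⟩ := hex
              exact .inr ⟨q', hq', (hiff q' hq').1 h'⟩
            · exact .inl h
          · exact .inr h
        · change _ ≤ O'.known.card + _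
          omega
        · have : O'.numWords = O.numWords := rfl
          change learnerRank B (.closing O' W) < _
          simp only [learnerRank, toLex_lt_toLex_iff, true_and, this]
          omega
      · have hsep : ∀ p ∈ O'.Q i, ¬ TestEquiv L (O'.C i) (q ++ m) p :=
          fun p hp h => hex ⟨p, hp, (hiff p hp).2 h⟩
        have hnew : (O'.addState i (q ++ m)).Sound L :=
          hS'.addState (hS.wellMatched_append hq hm) hsep
        have hn : (O'.addState i (q ++ m)).numWords = O.numWords + 1 :=
          numWords_addState fun hp => hsep _ hp (.refl _)
        refine ⟨⟨hnew, ?_, ?_, ?_, ?_⟩, ?_⟩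
        · exact Covered.addState (O := O') hC
        · exact Pending.addState (O := O') hP
        · change e + 1 ≤ (O'.addState i (q ++ m)).numWords
          omega
        · have : O'.known.card ≤ (O'.addState i (q ++ m)).known.card :=
            known_card_mono (fun j p hp => mem_Q_addState.2 (.inl hp)) (fun j => subset_rfl) rfl
          change _ ≤ (O'.addState i (q ++ m)).known.card + _
          omega
        · have := hB _ hnew
          change learnerRank B (.closing (O'.addState i (q ++ m)) _) < _
          simp only [learnerRank, toLex_lt_toLex_iff, true_and]
          omega
    | asking O => simp [act] at ha
    | searching O s lo hi =>
      obtain ⟨hR, hq, h₁, h₂, h₃, h₄, he, ha'⟩ := h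
      simp only [act] at ha
      split_ifs at ha with hlt
      -- Both halves have length at most `(d + 1) / 2` for `d = hi - lo`, so the potential `Nat.clog
      -- 2 (hi - lo)` drops by at least one and pays for the query.
      cases ha
      have hhalf : Nat.clog 2 (hi - (lo + hi) / 2) + 1 ≤ Nat.clog 2 (hi - lo) :=
        clog_two_half (by omega) (by omega)
      have hhalf' : Nat.clog 2 ((lo + hi) / 2 - lo) + 1 ≤ Nat.clog 2 (hi - lo) :=
        clog_two_half (by omega) (by omega)
      simp only [decide_eq_true_eq, Finset.card_singleton]
      split_ifs with hmid
      · refine ⟨⟨hR, hq, by omega, h₂, hmid, h₄, he, by omega⟩, ?_⟩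
        simp only [learnerRank, toLex_lt_toLex_iff, true_and]
        omega
      · refine ⟨⟨hR, hq, by omega, by omega, h₃, by tauto, he, by omega⟩, ?_⟩
        simp only [learnerRank, toLex_lt_toLex_iff, true_and]
        omega
    | done O => simp [act] at ha
  | @equivYes s H k a e n ha heq =>
    change VState t at s
    change act s = _ at ha
    change LearnerInvariant L a e n s at h
    change LearnerInvariant L a (e + 1) n (k none) ∧ learnerRank B (k none) < learnerRank B s
    cases s with
    | closing O W =>
      simp only [act, ask] at ha
      split_ifs at ha
    | checking O W i q m => simp [act, ask] at ha
    | asking O =>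
      obtain ⟨hR, he, ha'⟩ := h
      simp only [act] at ha
      cases ha
      refine ⟨⟨hR, recognizes_of_forall_mem_iff heq, he, ?_⟩, ?_⟩
      -- A positive answer also counts as an equivalence query; it takes the spare unit in `e + 1 ≤
      -- O.numWords`.
      · rw [Nat.succ_mul]
        omega
      · simp only [learnerRank, toLex_lt_toLex_iff, true_and]
        omega
    | searching O s lo hi =>
      simp only [act] at ha
      split_ifs at ha
    | done O => simp [act] at ha
  | @equivNo s H k a e n w ha hw =>
    change VState t at s
    change act s = _ at ha
    change LearnerInvariant L a e n s at h
    change LearnerInvariant L a (e + 1) (max n w.length) (k (some w)) ∧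
      learnerRank B (k (some w)) < learnerRank B s
    cases s with
    | closing O W =>
      simp only [act, ask] at ha
      split_ifs at ha
    | checking O W i q m => simp [act, ask] at ha
    | asking O =>
      simp only [act] at ha
      cases ha
      refine ⟨learnerInvariant_counterexample hg hgL h hw, ?_⟩
      simp only [learnerRank, toLex_lt_toLex_iff, true_and]
      omega
    | searching O s lo hi =>
      simp only [act] at ha
      split_ifs at ha
    | done O => simp [act] at ha

theorem exists_halt_of_stuck {L : Language A} {c : Snapshot (learner t).State}
    (h : LearnerInvariant L c.numMemb c.numEquiv c.maxLen c.state)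
    (hstuck : ∀ c', ¬ (learner t).Step (untaggedLanguage t) L c c') :
    ∃ O : Obs t, c.state = VState.done O := by
  classical
  obtain ⟨s, a, e, n⟩ := c
  change VState t at s
  cases s with
  | closing O W =>
    by_cases hW : W = ∅
    · have ha : (learner t).act (VState.closing O W) = ask O O.table .asking := if_pos hW
      exact (hstuck _ (.memb ha)).elim
    · obtain ⟨x, hx⟩ := Finset.nonempty_iff_ne_empty.2 hW
      refine (hstuck _ (.goto (N := _) (s' := VState.checking O (W.erase x) x.1 x.2.1 x.2.2)
        (if_neg hW) ⟨x, hx, ?_⟩)).elim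
      congr
  | checking O W i q m => exact (hstuck _ (.memb rfl)).elim
  | asking O =>
    by_cases heq : ∀ w, w ∈ L ↔ w ∈ untaggedLanguage t O.construct
    · exact (hstuck _ (.equivYes rfl heq)).elim
    · obtain ⟨w, hw⟩ := not_forall.1 heq
      exact (hstuck _ (.equivNo rfl hw)).elim
  | searching O s lo hi =>
    by_cases hlt : lo + 1 < hi
    · exact (hstuck _ (.memb (if_pos hlt))).elim
    · exact (hstuck _ (.goto (if_neg hlt) rfl)).elim
  | done O => exact ⟨O, rfl⟩

end Run

end VStar

/-! ### Termination, minimality and complexity -/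

theorem theorem1 :
    ∃ K : ℕ, ∀ (A : Type u) [Fintype A] [Nonempty A] (t : A → Kind) (L : Language A),
      IsVPL (taggedLanguage t L) →
      -- the learner terminates, whatever valid answers the teacher gives
      (¬ ∃ r : ℕ → Snapshot (learner t).State, r 0 = (learner t).init ∧
        ∀ j, (learner t).Step (untaggedLanguage t) L (r j) (r (j + 1))) ∧
      -- and every run that cannot be continued has halted with the minimal automaton
      ∀ c : Snapshot (learner t).State,
        Relation.ReflTransGen ((learner t).Step (untaggedLanguage t) L) (learner t).init c →
        (∀ c', ¬ (learner t).Step (untaggedLanguage t) L c c') →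
        ∃ H : KSEVPA (Call t) (Ret t) (Plain t),
          (learner t).act c.state = .halt H ∧
          H.IsMinimal (taggedLanguage t L) ∧
          (∀ N : KSEVPA (Call t) (Ret t) (Plain t),
            N.IsMinimal (taggedLanguage t L) → Nonempty (H.Iso N)) ∧
          c.numEquiv ≤ K * H.size ∧
          (c.numMemb : ℝ) ≤
            K * ((H.size : ℝ) ^ 3 * (Fintype.card A : ℝ) ^ 2 + H.size * Real.log c.maxLen) := by
  classical
  -- The table bound dictates `7`; the logarithmic term needs only `3`, and the equivalence queries
  -- `1`.
  refine ⟨7, fun A _ _ t L ⟨g, hg, hgL⟩ => ?_⟩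
  obtain ⟨κ, _, sig, hsig⟩ := exists_finite_signature hg
  simp only [hgL] at hsig
  have hB : ∀ O : Obs t, O.Sound L → O.numWords ≤ Fintype.card (Option (Call t)) * Nat.card κ :=
    fun O hO => by convert hO.numWords_le hsig
  have hinit : LearnerInvariant L (learner t).init.numMemb (learner t).init.numEquiv
      (learner t).init.maxLen (learner t).init.state := learnerInvariant_init L
  refine ⟨?_, fun c hc hstuck => ?_⟩
  · rintro ⟨r, h0, hr⟩
    have hinv : ∀ j, LearnerInvariant L (r j).numMemb (r j).numEquiv (r j).maxLen (r j).state := by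
      intro j
      induction j with
      | zero => exact h0 ▸ hinit
      | succ j ih => exact (learner_step hg hgL hB (hr j) ih).1
    exact (RelEmbedding.natGT (r := (· < ·)) (fun j => learnerRank _ (r j).state) fun j =>
      (learner_step hg hgL hB (hr j) (hinv j)).2).not_wellFounded wellFounded_lt
  · have hinv : LearnerInvariant L c.numMemb c.numEquiv c.maxLen c.state := by
      clear hstuck
      induction hc with
      | refl => exact hinit
      | tail _ hstep ih => exact (learner_step hg hgL hB hstep ih).1
    obtain ⟨O, hO⟩ := exists_halt_of_stuck hinv hstuck
    rw [hO] at hinv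
    obtain ⟨hR, hrec, he, ha⟩ := hinv
    -- The result recognizes the language, so a minimal `N` is no larger than it, which is the size
    -- condition of `Ready.iso`.
    refine ⟨O.construct, by rw [hO]; rfl, ⟨hrec, fun N hN => hR.size_le hN⟩,
      fun N hN => ⟨hR.iso hN.1 (hN.2 _ hrec)⟩, ?_, ?_⟩
    · rw [O.size_construct]
      omega
    · rw [O.size_construct]
      have h₁ : c.numMemb ≤ 7 * (O.numWords ^ 3 * Fintype.card A ^ 2) +
          O.numWords * Nat.clog 2 c.maxLen :=
        ha.trans (Nat.add_le_add ((Finset.card_filter_le _ _).trans hR.card_table_le)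
          (Nat.mul_le_mul_right _ he))
      have h₂ := clog_two_le_log c.maxLen
      have h₃ : (0 : ℝ) ≤ Real.log c.maxLen := Real.log_natCast_nonneg _
      have h₄ : (c.numMemb : ℝ) ≤ 7 * ((O.numWords : ℝ) ^ 3 * (Fintype.card A : ℝ) ^ 2) +
          O.numWords * Nat.clog 2 c.maxLen := by exact_mod_cast h₁
      have h₅ : (O.numWords : ℝ) * Nat.clog 2 c.maxLen ≤
          O.numWords * (7 * Real.log c.maxLen) := by gcongr; linarith
      push_cast
      linarith
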